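/- Let $q\in L_2(0,\pi)$ be real valued and $h,H\in\mathbb R$. For $\rho\in\mathbb C$ let $\varphi(\rho,\cdot)$ be the solution of $-y''+q(x)y=\rho^2y$ on $[0,\pi]$ with $\varphi(\rho,0)=1$, $\varphi'(\rho,0)=h$. Let $\lambda_k=\rho_k^2$, $k=0,1,2,\dots$, be the eigenvalues of the problem $-y''+qy=\lambda y$, $y'(0)-hy(0)=0$, $y'(\pi)+Hy(\pi)=0$, and suppose that $0=\rho_0<\rho_1<\rho_2<\cdots$ (this is achieved by a shift of the potential). Put $\omega=h+H+\frac12\int_0^\pi q(t)\,dt$, and let $j_k(z)=\sqrt{\pi/(2z)}\,J_{k+1/2}(z)$ be the spherical Bessel functions (extended to entire functions). There are real coefficients $g_n(x),\gamma_n(x)$, $n\ge 0$, $x\in[0,\pi]$, such that for every $x\in[0,\pi]$ $$\varphi(\rho,x)=\cos\rho x+\sum_{n=0}^\infty(-1)^ng_n(x)j_{2n}(\rho x),$$ $$\varphi'(\rho,x)=-\rho\sin\rho x+\Bigl(h+\tfrac12\int_0^xq(s)\,ds\Bigr)\cos\rho x+\sum_{n=0}^\infty(-1)^n\gamma_n(x)j_{2n}(\rho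 x),$$ both series converging uniformly on every compact set of the complex $\rho$-plane. For any such coefficients set $h_n=\gamma_n(\pi)+Hg_n(\pi)$. Then: 1. $\omega=-h_0$. 2. For all $k=1,2,\dots$ the series below converges and $$h_0\cos\rho_k\pi-\sum_{n=0}^\infty(-1)^nh_nj_{2n}(\rho_k\pi)=-\rho_k\sin\rho_k\pi .$$ 3. The characteristic function $\Phi(\rho)=\varphi'(\rho,\pi)+H\varphi(\rho,\pi)$ satisfies, for all $\rho\in\mathbb C$, with a convergent series, $$\Phi(\rho)=-\rho\sin\rho\pi+\omega\cos\rho\pi+\sum_{n=0}^\infty(-1)^nh_nj_{2n}(\rho\pi).$$ 4. The system in 2 determines the $h_n$, and thereby $\omega$ and $\Phi$: one has $\sum_{n}h_n^2/(4n+1)<\infty$, and if a real sequence $(a_n)$ with $\sum_n a_n^2/(4n+1)<\infty$ satisfies $a_0\cos\rho_k\pi-\sum_{n}(-1)^na_nj_{2n}(\rho_k\pi)=-\rho_k\sin\rho_k\pi$ for all $k\ge1$ (the series being convergent), then $a_n=h_n$ for all $n$. -/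

import Mathlib

noncomputable section

namespace SturmLiouville

/-- The Bessel function of the first kind `J_ν(z)`, with the principal branch of `(z/2)^ν`. -/
def besselJ (ν : ℝ) (z : ℂ) : ℂ :=
  (z / 2) ^ (ν : ℂ) *
    ∑' m : ℕ, (-1) ^ m / ((m.factorial : ℂ) * Complex.Gamma (m + ν + 1)) * (z / 2) ^ (2 * m)

/-- The spherical Bessel function `j_k(z) = √(π/(2z)) J_{k+1/2}(z)` as an entire function of `z`:
`j_k(z) = ∑ₘ (-1)ᵐ z^{k+2m} / (2ᵐ m! (2k+2m+1)!!)`. -/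
def sphericalBesselJ (k : ℕ) (z : ℂ) : ℂ :=
  ∑' m : ℕ, (-1) ^ m * z ^ (k + 2 * m) /
    (2 ^ m * (m.factorial : ℂ) * ((Nat.doubleFactorial (2 * k + 2 * m + 1) : ℕ) : ℂ))

/-- Off the branch cut, the series is the classical expression through `J_{k+1/2}`. -/
theorem sphericalBesselJ_eq (k : ℕ) {z : ℂ} (hz : z ∈ Complex.slitPlane) :
    sphericalBesselJ k z =
      ((Real.pi : ℂ) / (2 * z)) ^ (1 / 2 : ℂ) * besselJ (k + 1 / 2) z := by
  have hz0 : z ≠ 0 := Complex.slitPlane_ne_zero hz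
  have hpi : (0 : ℝ) < Real.pi := Real.pi_pos
  have hz2 : z / 2 ≠ 0 := div_ne_zero hz0 two_ne_zero
  have hz2s : z / 2 ∈ Complex.slitPlane := by
    rw [Complex.mem_slitPlane_iff] at hz ⊢
    rcases hz with hz | hz
    · left
      simp only [Complex.div_ofNat_re]
      linarith
    · right
      simp only [Complex.div_ofNat_im]
      exact div_ne_zero hz two_ne_zero
  have hsq : (Real.sqrt Real.pi : ℂ) = (Real.pi : ℂ) ^ (1 / 2 : ℂ) := by
    rw [Real.sqrt_eq_rpow, Complex.ofReal_cpow hpi.le]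
    norm_num
  have hs0 : (Real.pi : ℂ) ^ (1 / 2 : ℂ) ≠ 0 := by
    rw [← hsq]
    exact_mod_cast (Real.sqrt_pos.2 hpi).ne'
  have hG : ∀ n : ℕ, Complex.Gamma ((n : ℂ) + 3 / 2) =
      ((Nat.doubleFactorial (2 * n + 1) : ℕ) : ℂ) * (Real.pi : ℂ) ^ (1 / 2 : ℂ) / 2 ^ (n + 1) := by
    intro n
    induction n with
    | zero =>
      have h1 : ((0 : ℕ) : ℂ) + 3 / 2 = 1 / 2 + 1 := by norm_num
      rw [h1, Complex.Gamma_add_one _ (by norm_num), Complex.Gamma_one_half_eq]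
      norm_num
      ring
    | succ n ih =>
      have h1 : ((n + 1 : ℕ) : ℂ) + 3 / 2 = ((n : ℂ) + 3 / 2) + 1 := by push_cast; ring
      have h2 : (n : ℂ) + 3 / 2 ≠ 0 := by
        intro h
        have := congrArg Complex.re h
        simp at this
        have hn : (0 : ℝ) ≤ n := Nat.cast_nonneg n
        linarith
      have h3 : 2 * (n + 1) + 1 = (2 * n + 1) + 2 := by ring
      rw [h1, Complex.Gamma_add_one _ h2, ih, h3, Nat.doubleFactorial_add_two]
      push_cast
      field_simp
      ring
  have hpre : ((Real.pi : ℂ) / (2 * z)) ^ (1 / 2 : ℂ) *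
      (z / 2) ^ (((k + 1 / 2 : ℝ) : ℂ)) =
      (Real.pi : ℂ) ^ (1 / 2 : ℂ) / 2 * (z / 2) ^ k := by
    have e1 : (Real.pi : ℂ) / (2 * z) = ((Real.pi / 4 : ℝ) : ℂ) * (z / 2)⁻¹ := by
      push_cast
      field_simp
      ring
    have e2 : (((k + 1 / 2 : ℝ) : ℂ)) = 1 / 2 + (k : ℂ) := by push_cast; ring
    have e3 : ((Real.pi / 4 : ℝ) : ℂ) ^ (1 / 2 : ℂ) = (Real.pi : ℂ) ^ (1 / 2 : ℂ) / 2 := by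
      rw [← hsq]
      have : Real.sqrt (Real.pi / 4) = Real.sqrt Real.pi / 2 := by
        rw [Real.sqrt_div hpi.le, show (4 : ℝ) = 2 ^ 2 by norm_num,
          Real.sqrt_sq (by norm_num)]
      rw [show (Real.sqrt Real.pi : ℂ) / 2 = ((Real.sqrt Real.pi / 2 : ℝ) : ℂ) by push_cast; rfl,
        ← this, Real.sqrt_eq_rpow, Complex.ofReal_cpow (by positivity)]
      norm_num
    have e4 : (z / 2)⁻¹ ^ (1 / 2 : ℂ) = ((z / 2) ^ (1 / 2 : ℂ))⁻¹ :=
      Complex.inv_cpow _ _ (Complex.slitPlane_arg_ne_pi hz2s)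
    have e5 : (z / 2) ^ (1 / 2 : ℂ) ≠ 0 := by
      rw [Complex.cpow_ne_zero_iff]
      exact Or.inl hz2
    have e6 : (((Real.pi / 4 : ℝ) : ℂ) * (z / 2)⁻¹) ^ (1 / 2 : ℂ) =
        ((Real.pi / 4 : ℝ) : ℂ) ^ (1 / 2 : ℂ) * (z / 2)⁻¹ ^ (1 / 2 : ℂ) := by
      have hp4 : (0 : ℝ) < Real.pi / 4 := by positivity
      have hp4c : ((Real.pi / 4 : ℝ) : ℂ) ≠ 0 := by exact_mod_cast hp4.ne'
      have hzi : (z / 2)⁻¹ ≠ 0 := inv_ne_zero hz2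
      rw [Complex.cpow_def_of_ne_zero (mul_ne_zero hp4c hzi), Complex.cpow_def_of_ne_zero hp4c,
        Complex.cpow_def_of_ne_zero hzi, ← Complex.exp_add, Complex.log_ofReal_mul hp4 hzi,
        Complex.ofReal_log hp4.le]
      ring_nf
    rw [e1, e2, Complex.cpow_add _ _ hz2, ← mul_assoc, e6, e3, e4,
      Complex.cpow_natCast]
    field_simp
  rw [besselJ, ← mul_assoc, hpre, sphericalBesselJ, ← tsum_mul_left]
  refine tsum_congr fun m => ?_
  have e : (m : ℂ) + ((k + 1 / 2 : ℝ) : ℂ) + 1 = ((k + m : ℕ) : ℂ) + 3 / 2 := by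
    push_cast
    ring
  have hd : ((Nat.doubleFactorial (2 * (k + m) + 1) : ℕ) : ℂ) ≠ 0 := by
    exact_mod_cast (Nat.doubleFactorial_pos _).ne'
  have hm : (m.factorial : ℂ) ≠ 0 := by exact_mod_cast m.factorial_ne_zero
  rw [e, hG, show 2 * k + 2 * m + 1 = 2 * (k + m) + 1 by ring, div_pow, div_pow]
  field_simp
  ring

/-- `y` is a solution on `[0, π]` of `-y'' + q y = lam y`, with derivative `dy`: `y` is
differentiable with derivative `dy`, and `dy` is absolutely continuous with `dy' = (q - lam) y`
almost everywhere, i.e. `dy` is the indefinite integral of `(q - lam) y`. -/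
def IsSolution (q : ℝ → ℝ) (lam : ℂ) (y dy : ℝ → ℂ) : Prop :=
  (∀ x ∈ Set.Icc 0 Real.pi, HasDerivWithinAt y (dy x) (Set.Icc 0 Real.pi) x) ∧
  ∀ x ∈ Set.Icc 0 Real.pi, dy x = dy 0 + ∫ t in (0 : ℝ)..x, ((q t : ℂ) - lam) * y t

/-- The spectrum of `-y'' + q y = lam y`, `y'(0) - h y(0) = 0`, `y'(π) + H y(π) = 0`: the set of
all complex `lam` for which there is a nontrivial solution. -/
def spectrum (q : ℝ → ℝ) (h H : ℝ) : Set ℂ :=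
  {lam | ∃ y dy : ℝ → ℂ, IsSolution q lam y dy ∧ dy 0 - h * y 0 = 0 ∧
    dy Real.pi + H * y Real.pi = 0 ∧ ∃ x ∈ Set.Icc 0 Real.pi, y x ≠ 0}

/-- `φ ρ` (with `x`-derivative `dφ ρ`) is, for every complex `ρ`, the solution of
`-y'' + q y = ρ² y` with `y(0) = 1`, `y'(0) = h`. -/
def IsPhi (q : ℝ → ℝ) (h : ℝ) (φ dφ : ℂ → ℝ → ℂ) : Prop :=
  ∀ ρ : ℂ, IsSolution q (ρ ^ 2) (φ ρ) (dφ ρ) ∧ φ ρ 0 = 1 ∧ dφ ρ 0 = h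

/-- The parameter `ω = h + H + ½ ∫₀^π q`. -/
def omega (q : ℝ → ℝ) (h H : ℝ) : ℝ :=
  h + H + 1 / 2 * ∫ t in (0 : ℝ)..Real.pi, q t

/-- `g` and `γ` are the coefficients of the Neumann series of Bessel functions of `φ` and of its
`x`-derivative `dφ`: for every `x ∈ [0, π]`,
`φ(ρ,x) = cos ρx + ∑ₙ (-1)ⁿ gₙ(x) j₂ₙ(ρx)` and
`φ'(ρ,x) = -ρ sin ρx + (h + ½ ∫₀ˣ q) cos ρx + ∑ₙ (-1)ⁿ γₙ(x) j₂ₙ(ρx)`,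
the series converging uniformly on every compact set of the complex `ρ`-plane. -/
def IsNSBF (q : ℝ → ℝ) (h : ℝ) (φ dφ : ℂ → ℝ → ℂ) (g γ : ℕ → ℝ → ℝ) : Prop :=
  ∀ x ∈ Set.Icc 0 Real.pi, ∀ K : Set ℂ, IsCompact K →
    TendstoUniformlyOn
      (fun (N : ℕ) (ρ : ℂ) => Complex.cos (ρ * x) +
        ∑ n ∈ Finset.range N, (-1) ^ n * (g n x : ℂ) * sphericalBesselJ (2 * n) (ρ * x))
      (fun ρ => φ ρ x) Filter.atTop K ∧
    TendstoUniformlyOn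
      (fun (N : ℕ) (ρ : ℂ) => -ρ * Complex.sin (ρ * x) +
        ((h + 1 / 2 * ∫ s in (0 : ℝ)..x, q s : ℝ) : ℂ) * Complex.cos (ρ * x) +
        ∑ n ∈ Finset.range N, (-1) ^ n * (γ n x : ℂ) * sphericalBesselJ (2 * n) (ρ * x))
      (fun ρ => dφ ρ x) Filter.atTop K

/-- The sequence `a` solves the linear system
`a₀ cos ρₖπ - ∑ₙ (-1)ⁿ aₙ j₂ₙ(ρₖπ) = -ρₖ sin ρₖπ`, `k = 1, 2, …`, with convergent series. -/
def SolvesSystem (ρ : ℕ → ℝ) (a : ℕ → ℝ) : Prop :=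
  ∀ k : ℕ, 1 ≤ k →
    Summable (fun n : ℕ => (-1) ^ n * (a n : ℂ) * sphericalBesselJ (2 * n) (ρ k * Real.pi)) ∧
    a 0 * Complex.cos (ρ k * Real.pi) -
      ∑' n : ℕ, (-1) ^ n * (a n : ℂ) * sphericalBesselJ (2 * n) (ρ k * Real.pi) =
    -ρ k * Complex.sin (ρ k * Real.pi)

end SturmLiouville

end

/-!
The proof replaces the coefficients by square integrable kernels. There are `f_x ∈ L²(0, 1)`,
bounded uniformly in `x`, with `φ(ρ, x) = cos ρx + ⟪f_x, cos (ρx ·)⟫` for all `ρ`; a similar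
formula holds for `φ'`, and hence one for the characteristic function,
`Φ(ρ) = -ρ sin ρπ + ω cos ρπ + ⟪f, cos (ρπ ·)⟫`.

*Existence of the kernels.* For a cosine polynomial `u(y) = ∑ c_ρ cos ρy`, the function
`w(x, y) = ∑ c_ρ φ(ρ, x) cos ρy` solves the wave equation `w_xx - q w = w_yy` with data `w = u`,
`w_x = h u` at `x = 0`. Duhamel's formula and an exponentially weighted Volterra estimate bound
the difference of `w` and `(u(y + x) + u(y - x)) / 2` on the triangle `|y| ≤ x₀ - x` by a multiple
of the `L²(0, x₀)` norm of `u` (`IsPhi.exists_norm_waveDiff_le`). So `∑ c_ρ (φ(ρ, x) - cos ρx)` is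
a bounded linear functional of the cosine polynomial in the `L²` norm, and the theorems of
Hahn–Banach and Riesz give the kernel (`IsPhi.exists_inner_cosVec`,
`IsPhi.exists_inner_cosVec_deriv`). No Goursat problem has to be solved and no regularity of the
kernel is needed.

*Neumann series.* The Legendre polynomials of even degree form an orthogonal basis of `L²(0, 1)`,
and the inner product of `P_{2n}` with `t ↦ cos zt` is `(-1)ⁿ j_{2n}(z)`
(`inner_evenLegendreMap_cosVec`). Parseval's identity turns `⟪f, cos (z ·)⟫` into a Neumann series
that converges uniformly on bounded sets, and the condition `∑ aₙ² / (4 n + 1) < ∞` says that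
`(aₙ)` comes from some `f ∈ L²(0, 1)`. Since `j_{2n}` has a zero of order exactly `2 n` at the
origin, the maximum principle shows that the coefficients are unique
(`eq_zero_of_tendstoUniformlyOn`). Therefore `hₙ` are the coefficients of the kernel of `Φ`, which
is the series for `Φ`. The zeros of `Φ` are the `±ρ_k`; `Φ(0) = 0` gives `ω = -h₀`, and
`Φ(ρ_k) = 0` is the linear system.

*Uniqueness.* The difference of two solutions of the system yields an even entire function
`G(ρ) = b cos ρπ - ⟪f, cos (ρπ ·)⟫` that vanishes at all `±ρ_k`; at `ρ₀ = 0` it does so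
automatically, as `b` is the coefficient of `j₀` in the series. By the Wronskian identity the
zeros of `Φ` are simple in `ρ²`, so `G / Φ` is entire. On the squares of half-side `N + 1/2` the
term `ρ sin ρπ` dominates in `Φ`, and `G / Φ = O(1 / N)` there; hence `G = 0`
(`IsPhi.eq_zero_of_vanishes`). On the imaginary axis `⟪f, cos (ρπ ·)⟫` is of smaller order than
`cos ρπ`, so `b = 0` (`eq_zero_of_forall_cos_eq`), and uniqueness of Neumann coefficients finishes
the proof.
-/

noncomputable section

namespace SturmLiouville

/-! ### Even Legendre polynomials and their moments -/

section Legendre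

open Polynomial MeasureTheory unitInterval

/-- The pair `(A, B)` with `P_{2n}(t) = A(t²)` and `P_{2n+1}(t) = t B(t²)`, where `P_k` are the
Legendre polynomials. The recursion is two steps of Bonnet's recursion
`(k + 1) P_{k+1} = (2 k + 1) t P_k - k P_{k-1}`. -/
def legendrePair : ℕ → ℝ[X] × ℝ[X]
  | 0 => (1, 1)
  | n + 1 =>
    let A := C ((4 * n + 3) / (2 * n + 2) : ℝ) * (X * (legendrePair n).2) -
      C ((2 * n + 1) / (2 * n + 2) : ℝ) * (legendrePair n).1
    (A, C ((4 * n + 5) / (2 * n + 3) : ℝ) * A -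
      C ((2 * n + 2) / (2 * n + 3) : ℝ) * (legendrePair n).2)

/-- The polynomial `A` with `A(t²) = P_{2n}(t)`, where `P_{2n}` is the Legendre polynomial. -/
abbrev evenLegendre (n : ℕ) : ℝ[X] := (legendrePair n).1

lemma legendrePair_fst_succ (n : ℕ) : (legendrePair (n + 1)).1 =
    C ((4 * n + 3) / (2 * n + 2) : ℝ) * (X * (legendrePair n).2) -
      C ((2 * n + 1) / (2 * n + 2) : ℝ) * (legendrePair n).1 := rfl

lemma legendrePair_snd_succ (n : ℕ) : (legendrePair (n + 1)).2 =
    C ((4 * n + 5) / (2 * n + 3) : ℝ) * (legendrePair (n + 1)).1 -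
      C ((2 * n + 2) / (2 * n + 3) : ℝ) * (legendrePair n).2 := rfl

lemma coeff_legendrePair_of_lt (n : ℕ) : ∀ k, n < k →
    (legendrePair n).1.coeff k = 0 ∧ (legendrePair n).2.coeff k = 0 := by
  induction n with
  | zero =>
    intro k hk
    have : k ≠ 0 := by omega
    simp [legendrePair, coeff_one, this]
  | succ n ih =>
    intro k hk
    obtain ⟨k, rfl⟩ : ∃ j, k = j + 1 := ⟨k - 1, by omega⟩
    have h1 : (legendrePair (n + 1)).1.coeff (k + 1) = 0 := by
      rw [legendrePair_fst_succ, coeff_sub, coeff_C_mul, coeff_C_mul, coeff_X_mul,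
        (ih k (by omega)).2, (ih (k + 1) (by omega)).1]
      simp
    refine ⟨h1, ?_⟩
    rw [legendrePair_snd_succ, coeff_sub, coeff_C_mul, coeff_C_mul, h1,
      (ih (k + 1) (by omega)).2]
    simp

lemma natDegree_evenLegendre_lt (n : ℕ) : (evenLegendre n).natDegree < n + 1 :=
  Nat.lt_succ_of_le (natDegree_le_iff_coeff_eq_zero.2 fun k hk =>
    (coeff_legendrePair_of_lt n k hk).1)

lemma coeff_legendrePair_succ (n : ℕ) :
    (legendrePair (n + 1)).1.coeff (n + 1) =
      (4 * n + 3) / (2 * n + 2) * (legendrePair n).2.coeff n ∧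
    (legendrePair (n + 1)).2.coeff (n + 1) =
      (4 * n + 5) / (2 * n + 3) * (legendrePair (n + 1)).1.coeff (n + 1) := by
  constructor
  · rw [legendrePair_fst_succ, coeff_sub, coeff_C_mul, coeff_C_mul, coeff_X_mul,
      (coeff_legendrePair_of_lt n (n + 1) (by omega)).1]
    simp
  · rw [legendrePair_snd_succ, coeff_sub, coeff_C_mul, coeff_C_mul,
      (coeff_legendrePair_of_lt n (n + 1) (by omega)).2]
    simp

/-- The leading coefficient of `P_{2n}`, in the form in which it enters its `L²` norm; the leading
coefficient of `P_{2n+1}` carries the induction. -/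
lemma coeff_evenLegendre_mul (n : ℕ) :
    (evenLegendre n).coeff n * ((2 * n).factorial / (4 * n + 1).doubleFactorial : ℝ) =
      1 / (4 * n + 1) ∧
    (legendrePair n).2.coeff n = (4 * n + 1) / (2 * n + 1) * (evenLegendre n).coeff n := by
  induction n with
  | zero => simp [legendrePair, evenLegendre]
  | succ n ih =>
    obtain ⟨h1, h2⟩ := coeff_legendrePair_succ n
    have hd : ((4 * n + 1).doubleFactorial : ℝ) ≠ 0 := by
      exact_mod_cast (Nat.doubleFactorial_pos _).ne'
    constructor
    · rw [evenLegendre, h1, ih.2, show 2 * (n + 1) = 2 * n + 1 + 1 by ring,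
        Nat.factorial_succ, Nat.factorial_succ, show 4 * (n + 1) + 1 = 4 * n + 1 + 2 + 2 by ring,
        Nat.doubleFactorial_add_two, Nat.doubleFactorial_add_two]
      have h3 : (evenLegendre n).coeff n * (2 * n).factorial * (4 * n + 1) =
          (4 * n + 1).doubleFactorial := by
        have h := ih.1
        have e : (0 : ℝ) < 4 * n + 1 := by positivity
        rw [eq_div_iff e.ne'] at h
        field_simp at h
        exact h
      push_cast
      rw [← h3] at hd ⊢
      have ha : (evenLegendre n).coeff n ≠ 0 := fun h0 => hd (by rw [h0]; ring)
      have hf : ((2 * n).factorial : ℝ) ≠ 0 := by exact_mod_cast Nat.factorial_ne_zero _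
      field_simp
      ring
    · rw [h2]
      push_cast
      ring_nf

/-- The numerator `m (m - 2) ⋯ (m - 2 n + 2)` of the `m`-th moment of `P_{2n}` on `[0, 1]`. -/
def momentNum (n : ℕ) (m : ℝ) : ℝ := ∏ i ∈ Finset.range n, (m - 2 * i)

/-- The denominator `(m + 1) (m + 3) ⋯ (m + 2 n + 1)` of the `m`-th moment of `P_{2n}` on
`[0, 1]`. -/
def momentDen (n : ℕ) (m : ℝ) : ℝ := ∏ i ∈ Finset.range (n + 1), (m + 1 + 2 * i)

lemma momentDen_pos (n m : ℕ) : 0 < momentDen n m :=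
  Finset.prod_pos fun i _ => by positivity

/-- The moments of the Legendre polynomials on `[0, 1]`. The even and odd degrees have to be
treated together, because Bonnet's recursion links them. In the second formula `m - 1` is a real
number, so that there is no truncation at `m = 0`. -/
lemma integral_pow_mul_legendrePair (n : ℕ) : ∀ m : ℕ,
    ∫ t in (0 : ℝ)..1, t ^ m * (legendrePair n).1.eval (t ^ 2) = momentNum n m / momentDen n m ∧
    ∫ t in (0 : ℝ)..1, t ^ m * (t * (legendrePair n).2.eval (t ^ 2)) =
      momentNum n (m - 1) / momentDen n (m + 1) := by
  induction n with
  | zero =>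
    intro m
    simp only [legendrePair, eval_one, mul_one, ← pow_succ, integral_pow]
    simp [momentNum, momentDen]
  | succ n ih =>
    have hA : ∀ m : ℕ, ∫ t in (0 : ℝ)..1, t ^ m * (legendrePair (n + 1)).1.eval (t ^ 2) =
        momentNum (n + 1) m / momentDen (n + 1) m := by
      intro m
      have e : ∀ t : ℝ, t ^ m * (legendrePair (n + 1)).1.eval (t ^ 2) =
          ((4 * n + 3) / (2 * n + 2) : ℝ) * (t ^ (m + 1) * (t * (legendrePair n).2.eval (t ^ 2))) -
          ((2 * n + 1) / (2 * n + 2) : ℝ) * (t ^ m * (legendrePair n).1.eval (t ^ 2)) := by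
        intro t
        rw [legendrePair_fst_succ]
        simp only [eval_sub, eval_mul, eval_C, eval_X]
        ring
      simp_rw [e]
      rw [intervalIntegral.integral_sub (Continuous.intervalIntegrable (by fun_prop) _ _)
        (Continuous.intervalIntegrable (by fun_prop) _ _), intervalIntegral.integral_const_mul,
        intervalIntegral.integral_const_mul, (ih _).1, (ih _).2]
      have d1 : momentDen (n + 1) m = (m + 1) * momentDen n (m + 1 + 1) := by
        rw [momentDen, Finset.prod_range_succ', momentDen, mul_comm]
        simp only [Nat.cast_zero, mul_zero, add_zero]
        congr 1
        exact Finset.prod_congr rfl fun i _ => by push_cast; ring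
      have d2 : momentDen (n + 1) m = momentDen n m * (m + 1 + 2 * (n + 1)) := by
        rw [momentDen, Finset.prod_range_succ, momentDen]; push_cast; rfl
      have d3 : momentNum (n + 1) m = momentNum n m * (m - 2 * n) := by
        rw [momentNum, Finset.prod_range_succ, momentNum]
      have p0 := (momentDen_pos n m).ne'
      have p1 := (momentDen_pos (n + 1) m).ne'
      have p2 := (momentDen_pos n (m + 2)).ne'
      have p3 : ((m:ℝ) + 1) ≠ 0 := by positivity
      have p4 : ((m:ℝ) + 1 + 2 * (n + 1)) ≠ 0 := by positivity
      have q1 : momentDen n ((m:ℝ) + 1 + 1) = momentDen (n + 1) m / (m + 1) := by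
        rw [d1]; field_simp
      have q2 : momentDen n (m:ℝ) = momentDen (n + 1) m / (m + 1 + 2 * (n + 1)) := by
        rw [d2]; field_simp
      push_cast
      rw [q1, q2, d3, show ((m:ℝ) + 1 - 1) = m by ring]
      field_simp
      ring
    intro m
    refine ⟨hA m, ?_⟩
    have e : ∀ t : ℝ, t ^ m * (t * (legendrePair (n + 1)).2.eval (t ^ 2)) =
          ((4 * n + 5) / (2 * n + 3) : ℝ) * (t ^ (m + 1) * (legendrePair (n + 1)).1.eval (t ^ 2)) -
          ((2 * n + 2) / (2 * n + 3) : ℝ) * (t ^ m * (t * (legendrePair n).2.eval (t ^ 2))) := by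
      intro t
      rw [legendrePair_snd_succ]
      simp only [eval_sub, eval_mul, eval_C]
      ring
    simp_rw [e]
    rw [intervalIntegral.integral_sub (Continuous.intervalIntegrable (by fun_prop) _ _)
        (Continuous.intervalIntegrable (by fun_prop) _ _), intervalIntegral.integral_const_mul,
        intervalIntegral.integral_const_mul, hA, (ih _).2]
    have d2 : momentDen (n + 1) (m + 1) = momentDen n (m + 1) * (m + 2 + 2 * (n + 1)) := by
      rw [momentDen, Finset.prod_range_succ, momentDen]; push_cast; ring
    have d3 : momentNum (n + 1) (m + 1) = (m + 1) * momentNum n (m - 1) := by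
      rw [momentNum, Finset.prod_range_succ', momentNum, mul_comm]
      simp only [Nat.cast_zero, mul_zero, sub_zero]
      congr 1
      exact Finset.prod_congr rfl fun i _ => by push_cast; ring
    have d4 : momentNum (n + 1) (m - 1) = momentNum n (m - 1) * (m - 1 - 2 * n) := by
      rw [momentNum, Finset.prod_range_succ, momentNum]
    have p1 := (momentDen_pos n (m + 1)).ne'
    push_cast at p1 ⊢
    rw [d2, d3, d4]
    field_simp
    ring

lemma momentNum_of_lt {n m : ℕ} (h : m < n) : momentNum n (2 * m) = 0 :=
  Finset.prod_eq_zero (Finset.mem_range.2 h) (by ring)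

lemma momentNum_add (n j : ℕ) :
    momentNum n (2 * (n + j : ℕ)) * (2 ^ j * j.factorial) = 2 ^ (n + j) * (n + j).factorial := by
  induction n with
  | zero => simp [momentNum]
  | succ n ih =>
    rw [momentNum, Finset.prod_range_succ', show n + 1 + j = n + j + 1 by ring,
      Nat.factorial_succ, pow_succ]
    have : ∏ k ∈ Finset.range n, (2 * ((n + j + 1 : ℕ) : ℝ) - 2 * ((k + 1 : ℕ) : ℝ)) =
        momentNum n (2 * (n + j : ℕ)) := by
      rw [momentNum]
      exact Finset.prod_congr rfl fun i _ => by push_cast; ring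
    rw [this]
    push_cast at ih ⊢
    linear_combination 2 * (n + j + 1 : ℝ) * ih

lemma momentDen_mul (n m : ℕ) :
    momentDen n (2 * m) * (2 * m).factorial =
      (2 * m + 2 * n + 1).doubleFactorial * (2 ^ m * m.factorial) := by
  induction n with
  | zero =>
    have h := Nat.factorial_eq_mul_doubleFactorial (2 * m)
    rw [Nat.doubleFactorial_two_mul] at h
    have h' : ((2 * m + 1 : ℕ).factorial : ℝ) =
      (2 * m + 1).doubleFactorial * (2 ^ m * m.factorial) := by exact_mod_cast h
    rw [mul_zero, add_zero, ← h', Nat.factorial_succ]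
    simp [momentDen]
  | succ n ih =>
    rw [momentDen, Finset.prod_range_succ,
      show 2 * m + 2 * (n + 1) + 1 = 2 * m + 2 * n + 1 + 2 by ring,
      Nat.doubleFactorial_add_two]
    rw [momentDen] at ih
    push_cast
    linear_combination (2 * m + 2 * n + 3 : ℝ) * ih

/-- The moments of order at least `2 n`, in the shape of the coefficients of the power series of
`j_{2n}`. -/
lemma moment_eq (n j : ℕ) :
    momentNum n (2 * (n + j : ℕ)) / momentDen n (2 * (n + j : ℕ)) =
      (2 * (n + j)).factorial /
        (2 ^ j * j.factorial * (2 * (2 * n) + 2 * j + 1).doubleFactorial) := by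
  have h1 := momentNum_add n j
  have h2 := momentDen_mul n (n + j)
  have p := momentDen_pos n (2 * (n + j))
  have hj : (0:ℝ) < j.factorial := by exact_mod_cast j.factorial_pos
  have hd : (0:ℝ) < (2 * (2 * n) + 2 * j + 1).doubleFactorial := by
    exact_mod_cast Nat.doubleFactorial_pos _
  rw [show 2 * (n + j) + 2 * n + 1 = 2 * (2 * n) + 2 * j + 1 by ring] at h2
  push_cast at h1 h2 p ⊢
  rw [div_eq_div_iff p.ne' (by positivity)]
  linear_combination ((2 * (2 * n) + 2 * j + 1).doubleFactorial : ℝ) * h1 - h2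

end Legendre

/-! ### Fourier–Legendre expansion of `t ↦ cos (z t)` in `L²(0, 1)` -/

section FourierLegendre

open Polynomial MeasureTheory unitInterval

/-- The complex Hilbert space `L²(0, 1)`. -/
abbrev L2I := Lp ℂ 2 (volume : Measure I)

/-- The class in `L²(0, 1)` of a continuous function. -/
abbrev toL2I : C(I, ℂ) →L[ℂ] L2I := ContinuousMap.toLp 2 (volume : Measure I) ℂ

lemma integral_unitInterval {G : Type*} [NormedAddCommGroup G] [NormedSpace ℝ G] (f : ℝ → G) :
    ∫ t : I, f t = ∫ t in (0 : ℝ)..1, f t := by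
  rw [intervalIntegral.integral_of_le zero_le_one, ← integral_Icc_eq_integral_Ioc]
  exact integral_subtype measurableSet_Icc f

/-- The monomial `t ↦ t ^ (2 k)` on `[0, 1]`. -/
def evenPowMap (k : ℕ) : C(I, ℂ) := ⟨fun t => ((t : ℝ) : ℂ) ^ (2 * k), by fun_prop⟩

/-- The Legendre polynomial `P_{2n}` on `[0, 1]`. -/
def evenLegendreMap (n : ℕ) : C(I, ℂ) :=
  ⟨fun t => (((evenLegendre n).eval ((t : ℝ) ^ 2) : ℝ) : ℂ), by fun_prop⟩

/-- The function `t ↦ cos (z t)` on `[0, 1]`. -/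
def cosMap (z : ℂ) : C(I, ℂ) := ⟨fun t => Complex.cos (z * (t : ℝ)), by fun_prop⟩

lemma inner_evenLegendreMap_evenPowMap (n m : ℕ) :
    inner ℂ (toL2I (evenLegendreMap n)) (toL2I (evenPowMap m)) =
      ((momentNum n (2 * m) / momentDen n (2 * m) : ℝ) : ℂ) := by
  rw [ContinuousMap.inner_toLp]
  have h := (integral_pow_mul_legendrePair n (2 * m)).1
  push_cast at h
  rw [← h, ← intervalIntegral.integral_ofReal,
    ← integral_unitInterval fun t : ℝ =>
      ((t ^ (2 * m) * eval (t ^ 2) (legendrePair n).1 : ℝ) : ℂ)]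
  simp [evenLegendreMap, evenPowMap]

lemma evenLegendreMap_eq_sum (n : ℕ) : evenLegendreMap n =
    ∑ k ∈ Finset.range (n + 1), ((evenLegendre n).coeff k : ℂ) • evenPowMap k := by
  ext t
  simp only [evenLegendreMap, ContinuousMap.coe_mk, ContinuousMap.coe_sum, Finset.sum_apply,
    ContinuousMap.coe_smul, Pi.smul_apply, evenPowMap, smul_eq_mul]
  rw [eval_eq_sum_range' (natDegree_evenLegendre_lt n)]
  push_cast
  simp [pow_mul]

lemma inner_evenLegendreMap_of_lt {n m : ℕ} (h : m < n) :
    inner ℂ (toL2I (evenLegendreMap n)) (toL2I (evenLegendreMap m)) = 0 := by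
  rw [evenLegendreMap_eq_sum m, map_sum, inner_sum]
  refine Finset.sum_eq_zero fun k hk => ?_
  rw [map_smul, inner_smul_right, inner_evenLegendreMap_evenPowMap,
    momentNum_of_lt (by grind)]
  simp

lemma inner_evenLegendreMap_self (n : ℕ) :
    inner ℂ (toL2I (evenLegendreMap n)) (toL2I (evenLegendreMap n)) = 1 / (4 * n + 1) := by
  nth_rw 2 [evenLegendreMap_eq_sum n]
  rw [map_sum, inner_sum, Finset.sum_range_succ, Finset.sum_eq_zero, zero_add, map_smul,
    inner_smul_right, inner_evenLegendreMap_evenPowMap]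
  · have h1 := moment_eq n 0
    have h2 := (coeff_evenLegendre_mul n).1
    simp only [add_zero, mul_zero, pow_zero, Nat.factorial_zero, Nat.cast_one, one_mul] at h1
    rw [h1, show 2 * (2 * n) + 1 = 4 * n + 1 by ring]
    rw [← Complex.ofReal_mul, h2]
    push_cast
    rfl
  · intro k hk
    rw [map_smul, inner_smul_right, inner_evenLegendreMap_evenPowMap,
      momentNum_of_lt (Finset.mem_range.1 hk)]
    simp

/-- The Legendre polynomial `P_{2n}`, normalized in `L²(0, 1)`. -/
def legendreVec (n : ℕ) : L2I := ((√(4 * n + 1) : ℝ) : ℂ) • toL2I (evenLegendreMap n)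

lemma orthonormal_legendreVec : Orthonormal ℂ legendreVec := by
  rw [orthonormal_iff_ite]
  intro i j
  rw [legendreVec, legendreVec, inner_smul_left, inner_smul_right]
  rcases lt_trichotomy i j with h | rfl | h
  · rw [← inner_conj_symm, inner_evenLegendreMap_of_lt h, if_neg h.ne]; simp
  · rw [inner_evenLegendreMap_self, if_pos rfl, Complex.conj_ofReal]
    have h : ((√(4 * i + 1) : ℝ) : ℂ) * ((√(4 * i + 1) : ℝ) : ℂ) = 4 * i + 1 := by
      rw [← Complex.ofReal_mul, Real.mul_self_sqrt (by positivity)]; push_cast; rfl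
    have h0 : (4 * (i : ℂ) + 1) ≠ 0 := by exact_mod_cast (by positivity : (4 * (i : ℝ) + 1) ≠ 0)
    rw [← mul_assoc, h]
    field_simp
  · rw [inner_evenLegendreMap_of_lt h, if_neg h.ne']; simp

lemma toL2I_evenPowMap_mem_span (n : ℕ) :
    toL2I (evenPowMap n) ∈ Submodule.span ℂ (Set.range legendreVec) := by
  induction n using Nat.strong_induction_on with
  | _ n ih =>
    have h1 : toL2I (evenLegendreMap n) ∈ Submodule.span ℂ (Set.range legendreVec) := by
      have h0 : ((√(4 * n + 1) : ℝ) : ℂ) ≠ 0 := by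
        exact_mod_cast (Real.sqrt_pos.2 (by positivity)).ne'
      rw [← Submodule.smul_mem_iff _ h0]
      exact Submodule.subset_span ⟨n, rfl⟩
    have hc : ((evenLegendre n).coeff n : ℂ) ≠ 0 := by
      intro h
      have h2 := (coeff_evenLegendre_mul n).1
      rw [Complex.ofReal_eq_zero.1 h, zero_mul] at h2
      have : (0 : ℝ) < 1 / (4 * n + 1) := by positivity
      linarith
    rw [evenLegendreMap_eq_sum, Finset.sum_range_succ, map_add, map_sum, map_smul] at h1
    rw [← Submodule.smul_mem_iff _ hc]
    refine (Submodule.add_mem_iff_right _ (Submodule.sum_mem _ fun k hk => ?_)).1 h1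
    rw [map_smul]
    exact Submodule.smul_mem _ _ (ih k (Finset.mem_range.1 hk))

/-- Stone–Weierstrass: `t ↦ t²` separates the points of `[0, 1]`. -/
lemma dense_span_evenPowMap :
    (Submodule.span ℂ (Set.range evenPowMap)).topologicalClosure = ⊤ := by
  have hs : star (evenPowMap 1) = evenPowMap 1 := by
    ext t; simp [evenPowMap]
  have h := ContinuousMap.starSubalgebra_topologicalClosure_eq_top_of_separatesPoints
    (StarAlgebra.adjoin ℂ {evenPowMap 1}) (by
      intro x y hxy
      refine ⟨evenPowMap 1, ⟨evenPowMap 1, StarAlgebra.subset_adjoin _ _ rfl, rfl⟩, fun h => hxy ?_⟩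
      simp only [evenPowMap, ContinuousMap.coe_mk] at h
      have h' : (x : ℝ) ^ (2 * 1) = (y : ℝ) ^ (2 * 1) := by exact_mod_cast h
      exact Subtype.ext ((pow_left_inj₀ x.2.1 y.2.1 (by norm_num)).1 h'))
  rw [eq_top_iff]
  intro f _
  have hf : f ∈ (StarAlgebra.adjoin ℂ {evenPowMap 1}).topologicalClosure := by rw [h]; trivial
  refine closure_mono ?_ hf
  intro g hg
  have hg' : g ∈ Algebra.adjoin ℂ {evenPowMap 1} := by
    have h2 := StarAlgebra.adjoin_toSubalgebra ℂ ({evenPowMap 1} : Set C(I, ℂ))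
    rw [Set.star_singleton, hs, Set.union_self] at h2
    rw [← h2]
    exact hg
  rw [Algebra.adjoin_singleton_eq_range_aeval] at hg'
  obtain ⟨p, rfl⟩ := hg'
  change aeval (evenPowMap 1) p ∈ _
  rw [aeval_eq_sum_range]
  refine Submodule.sum_mem _ fun k _ => Submodule.smul_mem _ _ (Submodule.subset_span ⟨k, ?_⟩)
  ext t
  simp [evenPowMap, pow_mul]

/-- The normalized Legendre polynomials of even degree as a Hilbert basis of `L²(0, 1)`. -/
def legendreBasis : HilbertBasis ℕ ℂ L2I :=
  HilbertBasis.mk orthonormal_legendreVec (by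
    have hd : DenseRange toL2I := ContinuousMap.toLp_denseRange ℂ _ ℂ (by norm_num)
    have h1 := hd.topologicalClosure_map_submodule dense_span_evenPowMap
    rw [← h1]
    refine Submodule.topologicalClosure_mono ?_
    rw [Submodule.map_span_le]
    rintro _ ⟨n, rfl⟩
    exact toL2I_evenPowMap_mem_span n)

lemma legendreBasis_apply (n : ℕ) : legendreBasis n = legendreVec n := by
  simp [legendreBasis]

/-- The function `t ↦ cos (z t)` as an element of `L²(0, 1)`. -/
def cosVec (z : ℂ) : L2I := toL2I (cosMap z)

/-- The power series of the cosine converges uniformly on `[0, 1]`. -/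
lemma hasSum_cosMap (z : ℂ) : HasSum
    (fun m : ℕ => ((-1) ^ m * z ^ (2 * m) / (2 * m).factorial : ℂ) • evenPowMap m) (cosMap z) := by
  have hs : Summable fun m : ℕ =>
      ((-1) ^ m * z ^ (2 * m) / (2 * m).factorial : ℂ) • evenPowMap m := by
    have h0 : Summable fun m : ℕ => ‖z‖ ^ (2 * m) / (2 * m).factorial :=
      (Real.summable_pow_div_factorial ‖z‖).comp_injective
        (mul_right_injective₀ (two_ne_zero' ℕ))
    refine Summable.of_norm_bounded h0 fun m => ?_
    rw [ContinuousMap.norm_le _ (by positivity)]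
    intro t
    have ht : ‖((t : ℝ) : ℂ) ^ (2 * m)‖ ≤ 1 := by
      rw [norm_pow, Complex.norm_real]
      refine pow_le_one₀ (norm_nonneg _) ?_
      rw [Real.norm_eq_abs, abs_of_nonneg t.2.1]
      exact t.2.2
    simp only [evenPowMap, ContinuousMap.coe_smul, ContinuousMap.coe_mk, Pi.smul_apply,
      smul_eq_mul, norm_mul, norm_div, norm_pow, norm_neg, norm_one, one_pow, one_mul,
      Complex.norm_natCast]
    simp only [norm_pow] at ht
    exact mul_le_of_le_one_right (by positivity) ht
  convert hs.hasSum
  ext t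
  rw [← ContinuousMap.tsum_apply hs]
  refine (Complex.hasSum_cos (z * (t : ℝ))).tsum_eq.symm.trans (tsum_congr fun m => ?_)
  simp only [evenPowMap, ContinuousMap.coe_smul, ContinuousMap.coe_mk, Pi.smul_apply, smul_eq_mul,
    mul_pow]
  ring

/-- Integrating the power series of `cos (z t)` against `P_{2n}` gives the power series of
`j_{2n}`: the first `n` terms drop out by orthogonality. -/
lemma hasSum_sphericalBesselJ (n : ℕ) (z : ℂ) :
    HasSum (fun m : ℕ => (-1) ^ m * z ^ (2 * n + 2 * m) /
      (2 ^ m * (m.factorial : ℂ) * ((Nat.doubleFactorial (2 * (2 * n) + 2 * m + 1) : ℕ) : ℂ)))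
      ((-1) ^ n * inner ℂ (toL2I (evenLegendreMap n)) (cosVec z)) := by
  have h := ((innerSL ℂ (toL2I (evenLegendreMap n))).comp toL2I).hasSum (hasSum_cosMap z)
  simp only [ContinuousLinearMap.comp_apply, map_smul, innerSL_apply_apply,
    inner_evenLegendreMap_evenPowMap, smul_eq_mul] at h
  have h2 : ∑ m ∈ Finset.range n, ((-1) ^ m * z ^ (2 * m) / (2 * m).factorial : ℂ) *
      ((momentNum n (2 * m) / momentDen n (2 * m) : ℝ) : ℂ) = 0 :=
    Finset.sum_eq_zero fun m hm => by
      rw [momentNum_of_lt (Finset.mem_range.1 hm)]; simp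
  have h3 := (hasSum_nat_add_iff n).2 (by rw [h2, add_zero]; exact h)
  have h4 := h3.mul_left ((-1 : ℂ) ^ n)
  change HasSum _ ((-1 : ℂ) ^ n * inner ℂ _ (toL2I (cosMap z)))
  refine (congrArg (fun F => HasSum F _) (funext fun m => ?_)).mp h4
  rw [add_comm m n, moment_eq n m]
  have hf : ((2 * (n + m)).factorial : ℂ) ≠ 0 := by exact_mod_cast Nat.factorial_ne_zero _
  have hm : (m.factorial : ℂ) ≠ 0 := by exact_mod_cast Nat.factorial_ne_zero _
  have hd : ((2 * (2 * n) + 2 * m + 1).doubleFactorial : ℂ) ≠ 0 := by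
    exact_mod_cast (Nat.doubleFactorial_pos _).ne'
  push_cast
  field_simp
  have : ((-1 : ℂ) ^ n) ^ 2 = 1 := by rw [← pow_mul, mul_comm, pow_mul]; simp
  rw [pow_add]
  linear_combination ((-1) ^ m * z ^ (2 * (n + m)) : ℂ) * this

/-- The unnormalized Fourier–Legendre coefficients of `t ↦ cos (z t)` are spherical Bessel
functions. -/
lemma inner_evenLegendreMap_cosVec (n : ℕ) (z : ℂ) :
    inner ℂ (toL2I (evenLegendreMap n)) (cosVec z) = (-1) ^ n * sphericalBesselJ (2 * n) z := by
  rw [sphericalBesselJ, (hasSum_sphericalBesselJ n z).tsum_eq, ← mul_assoc, ← mul_pow]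
  simp

end FourierLegendre

/-! ### Neumann series of spherical Bessel functions -/

section Neumann

open MeasureTheory unitInterval Filter Topology

lemma norm_cos_le (z : ℂ) : ‖Complex.cos z‖ ≤ Real.exp |z.im| := by
  rw [Complex.cos, norm_div]
  have h1 : ‖Complex.exp (z * Complex.I)‖ ≤ Real.exp |z.im| := by
    rw [Complex.norm_exp]; simpa using neg_le_abs z.im
  have h2 : ‖Complex.exp (-z * Complex.I)‖ ≤ Real.exp |z.im| := by
    rw [Complex.norm_exp]; simpa using le_abs_self z.im
  have h3 := norm_add_le (Complex.exp (z * Complex.I)) (Complex.exp (-z * Complex.I))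
  rw [Complex.norm_ofNat, div_le_iff₀ two_pos]
  linarith

lemma norm_cosVec_le (z : ℂ) : ‖cosVec z‖ ≤ Real.exp |z.im| := by
  have h1 : ‖toL2I‖ ≤ 1 := by
    have := ContinuousMap.toLp_norm_le (p := 2) (E := ℂ) (𝕜 := ℂ) (volume : Measure I)
    simpa [measureUnivNNReal] using this
  have h2 : ‖cosMap z‖ ≤ Real.exp |z.im| := by
    rw [ContinuousMap.norm_le _ (Real.exp_pos _).le]
    intro t
    refine (norm_cos_le _).trans (Real.exp_le_exp.2 ?_)
    rw [Complex.im_mul_ofReal, abs_mul, abs_of_nonneg t.2.1]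
    exact mul_le_of_le_one_right (abs_nonneg _) t.2.2
  exact (toL2I.le_of_opNorm_le h1 _).trans (by rwa [one_mul])

lemma cosVec_neg (z : ℂ) : cosVec (-z) = cosVec z := by
  have : cosMap (-z) = cosMap z := by ext t; simp [cosMap]
  rw [cosVec, this, cosVec]

/-- The coefficients of the Neumann series of `z ↦ ⟪f, cos (z ·)⟫`. The inner product is conjugate
linear in `f`, so they are weighted Fourier–Legendre coefficients of the conjugate of `f`. -/
def neumannCoeff (f : L2I) (n : ℕ) : ℂ := ((√(4 * n + 1) : ℝ) : ℂ) * inner ℂ f (legendreVec n)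

lemma inner_legendreVec_mul (f : L2I) (n : ℕ) (z : ℂ) :
    inner ℂ f (legendreVec n) * inner ℂ (legendreVec n) (cosVec z) =
      (-1) ^ n * neumannCoeff f n * sphericalBesselJ (2 * n) z := by
  nth_rw 2 [legendreVec]
  rw [inner_smul_left, inner_evenLegendreMap_cosVec, Complex.conj_ofReal, neumannCoeff]
  ring

/-- Parseval's identity for `f` and `t ↦ cos (z t)` is a Neumann series. -/
lemma hasSum_neumann (f : L2I) (z : ℂ) :
    HasSum (fun n : ℕ => (-1) ^ n * neumannCoeff f n * sphericalBesselJ (2 * n) z)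
      (inner ℂ f (cosVec z)) := by
  have h := legendreBasis.hasSum_inner_mul_inner f (cosVec z)
  simp only [legendreBasis_apply, inner_legendreVec_mul] at h
  exact h

/-- The convergence is uniform on bounded sets, since the partial sums are inner products of
`cos (z ·)` with the partial Fourier–Legendre sums of `f`. -/
lemma tendstoUniformlyOn_neumann (f : L2I) {K : Set ℂ} (hK : Bornology.IsBounded K) :
    TendstoUniformlyOn (fun (N : ℕ) (z : ℂ) =>
      ∑ n ∈ Finset.range N, (-1) ^ n * neumannCoeff f n * sphericalBesselJ (2 * n) z)
      (fun z => inner ℂ f (cosVec z)) atTop K := by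
  obtain ⟨R, hR⟩ := hK.exists_norm_le
  have hsum := (legendreBasis.hasSum_repr f).tendsto_sum_nat
  rw [Metric.tendstoUniformlyOn_iff]
  intro ε hε
  have hpos := Real.exp_pos R
  filter_upwards [Metric.tendsto_nhds.1 hsum (ε / Real.exp R) (by positivity)] with N hN z hz
  have e : ∑ n ∈ Finset.range N, (-1) ^ n * neumannCoeff f n * sphericalBesselJ (2 * n) z =
      inner ℂ (∑ n ∈ Finset.range N, legendreBasis.repr f n • legendreBasis n) (cosVec z) := by
    rw [sum_inner]
    refine Finset.sum_congr rfl fun n _ => ?_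
    rw [← inner_legendreVec_mul, inner_smul_left, HilbertBasis.repr_apply_apply,
      inner_conj_symm, legendreBasis_apply]
  rw [e, dist_eq_norm, ← inner_sub_left]
  rw [dist_comm, dist_eq_norm, lt_div_iff₀ hpos] at hN
  refine (norm_inner_le_norm _ _).trans_lt (lt_of_le_of_lt ?_ hN)
  gcongr
  refine (norm_cosVec_le z).trans (Real.exp_le_exp.2 ((Complex.abs_im_le_norm z).trans (hR z hz)))

lemma summable_neumannCoeff (f : L2I) :
    Summable fun n : ℕ => ‖neumannCoeff f n‖ ^ 2 / (4 * n + 1) := by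
  have h := orthonormal_legendreVec.inner_products_summable f
  refine h.congr fun n => ?_
  have h0 : (0 : ℝ) < 4 * n + 1 := by positivity
  rw [neumannCoeff, norm_mul, Complex.norm_real, Real.norm_eq_abs, mul_pow, sq_abs,
    Real.sq_sqrt h0.le, norm_inner_symm]
  field_simp

/-- The Riesz–Fischer theorem in terms of Neumann coefficients. -/
lemma exists_neumannCoeff_eq (a : ℕ → ℝ) (ha : Summable fun n : ℕ => a n ^ 2 / (4 * n + 1)) :
    ∃ f : L2I, ∀ n, neumannCoeff f n = a n := by
  let b : ℕ → ℂ := fun n => ((a n / √(4 * n + 1) : ℝ) : ℂ)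
  have hb : Memℓp b 2 := by
    rw [memℓp_gen_iff (by norm_num)]
    refine ha.congr fun n => ?_
    have h0 : (0 : ℝ) < 4 * n + 1 := by positivity
    simp only [b, Complex.norm_real, ENNReal.toReal_ofNat, Real.rpow_ofNat, Real.norm_eq_abs,
      sq_abs, div_pow, Real.sq_sqrt h0.le]
  refine ⟨legendreBasis.repr.symm ⟨b, hb⟩, fun n => ?_⟩
  have h1 := legendreBasis.repr_apply_apply (legendreBasis.repr.symm ⟨b, hb⟩) n
  rw [LinearIsometryEquiv.apply_symm_apply, legendreBasis_apply] at h1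
  have h0 : (0 : ℝ) < 4 * n + 1 := by positivity
  rw [neumannCoeff, ← inner_conj_symm, ← h1]
  change _ * (starRingEnd ℂ) (b n) = _
  simp only [b, Complex.conj_ofReal]
  rw [← Complex.ofReal_mul, mul_div_cancel₀ _ (Real.sqrt_pos.2 h0).ne']

/-- The entire function `z ↦ j_{2n}(z) / z^{2n}`, as a power series. -/
def reducedBesselJ (n : ℕ) (z : ℂ) : ℂ :=
  ∑' m : ℕ, (-1) ^ m * z ^ (2 * m) /
    (2 ^ m * (m.factorial : ℂ) * ((Nat.doubleFactorial (2 * (2 * n) + 2 * m + 1) : ℕ) : ℂ))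

lemma sphericalBesselJ_eq_pow_mul (n : ℕ) (z : ℂ) :
    sphericalBesselJ (2 * n) z = z ^ (2 * n) * reducedBesselJ n z := by
  rw [sphericalBesselJ, reducedBesselJ, ← tsum_mul_left]
  refine tsum_congr fun m => ?_
  rw [pow_add]
  ring

lemma reducedBesselJ_zero_ne (n : ℕ) : reducedBesselJ n 0 ≠ 0 := by
  rw [reducedBesselJ, tsum_eq_single 0 fun m hm => by simp [hm]]
  simpa using (Nat.doubleFactorial_pos (2 * (2 * n) + 1)).ne'

lemma differentiable_reducedBesselJ (n : ℕ) : Differentiable ℂ (reducedBesselJ n) := by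
  intro z
  have h : DifferentiableOn ℂ (reducedBesselJ n) (Metric.ball 0 (‖z‖ + 1)) := by
    refine Complex.differentiableOn_tsum_of_summable_norm (u := fun m : ℕ =>
      ((‖z‖ + 1) ^ 2) ^ m / m.factorial) (Real.summable_pow_div_factorial _)
      (fun m => by fun_prop) Metric.isOpen_ball fun m w hw => ?_
    have hw' : ‖w‖ ≤ ‖z‖ + 1 := by simpa using (Metric.mem_ball.1 hw).le
    have hm : (0 : ℝ) < m.factorial := by exact_mod_cast m.factorial_pos
    have hd : (1 : ℝ) ≤ (2 * (2 * n) + 2 * m + 1).doubleFactorial := by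
      exact_mod_cast Nat.doubleFactorial_pos _
    have h2 : (1 : ℝ) ≤ 2 ^ m := one_le_pow₀ one_le_two
    simp only [norm_div, norm_mul, norm_pow, norm_neg, norm_one, one_pow, one_mul,
      Complex.norm_natCast, Complex.norm_ofNat]
    rw [pow_mul]
    gcongr
    calc (m.factorial : ℝ) = 1 * m.factorial * 1 := by ring
      _ ≤ 2 ^ m * m.factorial * (2 * (2 * n) + 2 * m + 1).doubleFactorial := by gcongr
  exact (h.differentiableAt (Metric.isOpen_ball.mem_nhds (by simp)))

lemma differentiable_sphericalBesselJ (n : ℕ) : Differentiable ℂ (sphericalBesselJ (2 * n)) := by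
  rw [funext (sphericalBesselJ_eq_pow_mul n)]
  exact (differentiable_id.pow _).mul (differentiable_reducedBesselJ n)

/-- A Neumann series determines its coefficients. If all coefficients before the `n`-th vanish,
the partial sums are divisible by `z ^ (2 n)`; on the unit circle the division does not change
their size, and the maximum principle carries the bound to the origin, where only the `n`-th term
is left. -/
lemma eq_zero_of_tendstoUniformlyOn {a : ℕ → ℂ}
    (ha : TendstoUniformlyOn (fun (N : ℕ) (z : ℂ) =>
      ∑ n ∈ Finset.range N, (-1) ^ n * a n * sphericalBesselJ (2 * n) z)
      (fun _ => 0) atTop (Metric.sphere 0 1)) (n : ℕ) : a n = 0 := by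
  induction n using Nat.strong_induction_on with
  | _ n ih =>
    -- The quotient of a partial sum by `z ^ (2 n)`. The subtraction `k - n` truncates only for
    -- `k < n`, where `a k = 0`.
    let u : ℕ → ℂ → ℂ := fun N z => ∑ k ∈ Finset.range N,
      (-1) ^ k * a k * (z ^ (2 * (k - n)) * reducedBesselJ k z)
    have hu : ∀ N z, ∑ k ∈ Finset.range N, (-1) ^ k * a k * sphericalBesselJ (2 * k) z =
        z ^ (2 * n) * u N z := by
      intro N z
      rw [Finset.mul_sum]
      refine Finset.sum_congr rfl fun k _ => ?_
      rcases lt_or_ge k n with h | h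
      · rw [ih k h]; simp
      · rw [sphericalBesselJ_eq_pow_mul]
        nth_rw 1 [show 2 * k = 2 * n + 2 * (k - n) by omega]
        rw [pow_add]
        ring
    have hd : ∀ N, Differentiable ℂ (u N) := fun N => by
      have := differentiable_reducedBesselJ
      fun_prop
    have hu0 : ∀ N, n < N → u N 0 = (-1) ^ n * a n * reducedBesselJ n 0 := by
      intro N hN
      change ∑ k ∈ Finset.range N, _ = _
      rw [Finset.sum_eq_single n]
      · simp
      · intro k _ hk
        rcases lt_or_gt_of_ne hk with h | h
        · rw [ih k h]; simp
        · rw [zero_pow (by omega)]; simp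
      · intro h; exact absurd (Finset.mem_range.2 hN) h
    have hle : ∀ ε > 0, ‖a n * reducedBesselJ n 0‖ ≤ ε := by
      intro ε hε
      obtain ⟨N, hN⟩ := ((Metric.tendstoUniformlyOn_iff.1 ha ε hε).and
        (eventually_gt_atTop n)).exists
      have h := Complex.norm_le_of_forall_mem_frontier_norm_le
        (Metric.isBounded_ball (x := (0 : ℂ)) (r := 1))
        (hd N).diffContOnCl (C := ε) (fun z hz => by
          rw [frontier_ball _ one_ne_zero] at hz
          have h1 := (hN.1 z hz).le
          rw [hu, dist_zero_left, norm_mul, norm_pow, mem_sphere_zero_iff_norm.1 hz] at h1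
          simpa using h1) (subset_closure (Metric.mem_ball_self one_pos))
      rw [hu0 N hN.2] at h
      simpa using h
    have h0 : a n * reducedBesselJ n 0 = 0 := by
      rw [← norm_le_zero_iff]
      exact le_of_forall_gt_imp_ge_of_dense hle
    exact (mul_eq_zero.1 h0).resolve_right (reducedBesselJ_zero_ne n)

lemma differentiable_inner_cosVec (f : L2I) : Differentiable ℂ fun z => inner ℂ f (cosVec z) := by
  intro z
  have h : DifferentiableOn ℂ (fun z => inner ℂ f (cosVec z)) (Metric.ball 0 (‖z‖ + 1)) := by
    refine (tendstoUniformlyOn_neumann f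
      Metric.isBounded_ball).tendstoLocallyUniformlyOn.differentiableOn
      (Eventually.of_forall fun N => ?_) Metric.isOpen_ball
    have := differentiable_sphericalBesselJ
    have h2 : Differentiable ℂ fun z => ∑ n ∈ Finset.range N,
        (-1) ^ n * neumannCoeff f n * sphericalBesselJ (2 * n) z := by fun_prop
    exact h2.differentiableOn
  exact (h.differentiableAt (Metric.isOpen_ball.mem_nhds (by simp)))

end Neumann

/-! ### Solutions of the Sturm–Liouville equation with a square integrable potential -/

section Equation

open MeasureTheory Filter Topology Set intervalIntegral

lemma absolutelyContinuousOnInterval_ofReal {f : ℝ → ℝ} {a b : ℝ}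
    (hf : AbsolutelyContinuousOnInterval f a b) :
    AbsolutelyContinuousOnInterval (fun x => (f x : ℂ)) a b := by
  unfold AbsolutelyContinuousOnInterval at hf ⊢
  simpa only [Complex.dist_of_im_eq, Complex.ofReal_im, Complex.ofReal_re] using hf

lemma absolutelyContinuousOnInterval_congr {f g : ℝ → ℂ} {a b : ℝ}
    (hf : AbsolutelyContinuousOnInterval f a b) (h : EqOn f g (uIcc a b)) :
    AbsolutelyContinuousOnInterval g a b := by
  refine Tendsto.congr' ?_ hf
  rw [EventuallyEq, eventually_inf_principal]
  filter_upwards with E hE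
  refine Finset.sum_congr rfl fun i hi => ?_
  rw [h (hE.1 i hi).1, h (hE.1 i hi).2]

/-- The indefinite integral of an integrable complex function is absolutely continuous; the real
and imaginary parts are treated separately. -/
lemma absolutelyContinuousOnInterval_integral {w : ℝ → ℂ} {b : ℝ}
    (h : IntervalIntegrable w volume 0 b) :
    AbsolutelyContinuousOnInterval (fun x => ∫ t in (0 : ℝ)..x, w t) 0 b := by
  have hre : IntervalIntegrable (fun t => (w t).re) volume 0 b := ⟨h.1.re, h.2.re⟩
  have him : IntervalIntegrable (fun t => (w t).im) volume 0 b := ⟨h.1.im, h.2.im⟩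
  have h1 := absolutelyContinuousOnInterval_ofReal
    (hre.absolutelyContinuousOnInterval_intervalIntegral (c := 0) left_mem_uIcc)
  have h2 := (absolutelyContinuousOnInterval_ofReal
    (him.absolutelyContinuousOnInterval_intervalIntegral (c := 0) left_mem_uIcc)).const_smul
      Complex.I
  have h3 := h1.add h2
  have hofReal : ∀ {f : ℝ → ℝ} {x : ℝ}, IntervalIntegrable f volume 0 x →
      IntervalIntegrable (fun t => (f t : ℂ)) volume 0 x := fun h => ⟨h.1.ofReal, h.2.ofReal⟩
  have hsub : ∀ x ∈ uIcc 0 b, ∫ t in (0 : ℝ)..x, w t =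
      ((∫ t in (0 : ℝ)..x, (w t).re : ℝ) : ℂ) +
        Complex.I • ((∫ t in (0 : ℝ)..x, (w t).im : ℝ) : ℂ) := by
    intro x hx
    have hm := uIcc_subset_uIcc left_mem_uIcc hx
    rw [← intervalIntegral.integral_ofReal, ← intervalIntegral.integral_ofReal,
      ← intervalIntegral.integral_smul]
    refine Eq.trans (integral_congr fun t _ => ?_) (integral_add (hofReal (hre.mono_set hm))
      ((hofReal (him.mono_set hm)).smul Complex.I))
    simp only [smul_eq_mul, mul_comm Complex.I]
    exact (Complex.re_add_im _).symm
  exact absolutelyContinuousOnInterval_congr h3 fun x hx => (hsub x hx).symm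

/-- Integration by parts for indefinite integrals of integrable functions: the product of the two
absolutely continuous functions has the expected derivative almost everywhere. -/
lemma integral_deriv_mul_of_eq_integral {u u' v v' : ℝ → ℂ} {b : ℝ} (hb : 0 ≤ b)
    (hu' : IntervalIntegrable u' volume 0 b) (hv' : IntervalIntegrable v' volume 0 b)
    (hu : ∀ x ∈ Icc 0 b, u x = u 0 + ∫ t in (0 : ℝ)..x, u' t)
    (hv : ∀ x ∈ Icc 0 b, v x = v 0 + ∫ t in (0 : ℝ)..x, v' t) :
    ∫ t in (0 : ℝ)..b, (u' t * v t + u t * v' t) = u b * v b - u 0 * v 0 := by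
  have hac : ∀ (w w' : ℝ → ℂ), IntervalIntegrable w' volume 0 b →
      AbsolutelyContinuousOnInterval (fun x => w 0 + ∫ t in (0 : ℝ)..x, w' t) 0 b :=
    fun w w' h => by
      have h1 : AbsolutelyContinuousOnInterval (fun _ : ℝ => w 0) 0 b :=
        (LipschitzWith.const (w 0)).lipschitzOnWith.absolutelyContinuousOnInterval
      have h2 := absolutelyContinuousOnInterval_integral h
      exact h1.add h2
  have hmem : ∀ {x}, x ∈ uIcc 0 b → x ∈ Icc 0 b := fun h => by rwa [uIcc_of_le hb] at h
  have hcu : ContinuousOn u (uIcc 0 b) :=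
    (hac u u' hu').continuousOn.congr fun x hx => hu x (hmem hx)
  have hcv : ContinuousOn v (uIcc 0 b) :=
    (hac v v' hv').continuousOn.congr fun x hx => hv x (hmem hx)
  have hint : IntervalIntegrable (fun t => u' t * v t + u t * v' t) volume 0 b :=
    (hu'.mul_continuousOn hcv).add (hv'.continuousOn_mul hcu)
  obtain ⟨C, hC⟩ := AbsolutelyContinuousOnInterval.const_of_ae_hasDerivAt_zero
    (f := fun x => (u 0 + ∫ t in (0 : ℝ)..x, u' t) * (v 0 + ∫ t in (0 : ℝ)..x, v' t) -
      ∫ t in (0 : ℝ)..x, (u' t * v t + u t * v' t)) (a := 0) (b := b)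
    (((hac u u' hu').fun_smul (hac v v' hv')).fun_sub
      (absolutelyContinuousOnInterval_integral hint))
    (by
      filter_upwards [hu'.ae_hasDerivAt_integral, hv'.ae_hasDerivAt_integral,
        hint.ae_hasDerivAt_integral] with x h1 h2 h3 hx
      have e1 := (h1 hx 0 left_mem_uIcc).const_add (u 0)
      have e2 := (h2 hx 0 left_mem_uIcc).const_add (v 0)
      have e := (e1.mul e2).sub (h3 hx 0 left_mem_uIcc)
      refine e.congr_deriv ?_
      rw [← hu x (hmem hx), ← hv x (hmem hx)]
      ring)
  have h0 := hC 0 left_mem_uIcc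
  have h1 := hC b right_mem_uIcc
  simp only [integral_same, add_zero, sub_zero] at h0
  rw [← hu b ⟨hb, le_rfl⟩, ← hv b ⟨hb, le_rfl⟩, ← h0] at h1
  rw [← h1]
  ring

lemma integral_deriv_mul_of_hasDerivAt_left {u u' v v' : ℝ → ℂ} {b : ℝ} (hb : 0 ≤ b)
    (hu : ∀ x, HasDerivAt u (u' x) x) (hu' : Continuous u') (hv' : IntervalIntegrable v' volume 0 b)
    (hv : ∀ x ∈ Icc 0 b, v x = v 0 + ∫ t in (0 : ℝ)..x, v' t) :
    ∫ t in (0 : ℝ)..b, (u' t * v t + u t * v' t) = u b * v b - u 0 * v 0 :=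
  integral_deriv_mul_of_eq_integral hb (hu'.intervalIntegrable _ _) hv'
    (fun x _ => by
      rw [integral_eq_sub_of_hasDerivAt (fun t _ => hu t) (hu'.intervalIntegrable _ _)]
      ring) hv

section Potential

variable {q : ℝ → ℝ}

/-- The potential `q` belongs to `L²(0, π)`. -/
abbrev IsSquareIntegrable (q : ℝ → ℝ) : Prop :=
  MemLp q 2 (volume.restrict (Ioo 0 Real.pi))

lemma IsSquareIntegrable.memLp_Ioc (hq : IsSquareIntegrable q) {x : ℝ} (hx : x ∈ Icc 0 Real.pi) :
    MemLp q 2 (volume.restrict (Ioc 0 x)) := by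
  have h : MemLp q 2 (volume.restrict (Ioc 0 Real.pi)) := by
    rwa [← restrict_Ioo_eq_restrict_Ioc]
  exact h.mono_measure (Measure.restrict_mono (Ioc_subset_Ioc_right hx.2) le_rfl)

lemma IsSquareIntegrable.intervalIntegrable (hq : IsSquareIntegrable q) {x : ℝ}
    (hx : x ∈ Icc 0 Real.pi) : IntervalIntegrable q volume 0 x := by
  rw [intervalIntegrable_iff_integrableOn_Ioc_of_le hx.1]
  exact (hq.memLp_Ioc hx).integrable (by norm_num)

lemma IsSquareIntegrable.intervalIntegrable_ofReal (hq : IsSquareIntegrable q) {x : ℝ}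
    (hx : x ∈ Icc 0 Real.pi) : IntervalIntegrable (fun t => (q t : ℂ)) volume 0 x :=
  ⟨(hq.intervalIntegrable hx).1.ofReal, (hq.intervalIntegrable hx).2.ofReal⟩

/-- The Cauchy–Schwarz inequality on `[0, x]`. -/
lemma integral_abs_mul_le {f g : ℝ → ℝ} {x : ℝ} (hx : 0 ≤ x)
    (hf : MemLp f 2 (volume.restrict (Ioc 0 x))) (hg : MemLp g 2 (volume.restrict (Ioc 0 x))) :
    ∫ s in (0 : ℝ)..x, |f s| * |g s| ≤
      √(∫ s in (0 : ℝ)..x, f s ^ 2) * √(∫ s in (0 : ℝ)..x, g s ^ 2) := by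
  have h := integral_mul_norm_le_Lp_mul_Lq (μ := volume.restrict (Ioc 0 x)) (f := f) (g := g)
    Real.HolderConjugate.two_two (by simpa using hf) (by simpa using hg)
  simp only [integral_of_le hx, Real.sqrt_eq_rpow]
  simpa using h

/-- The `L²` norm of the potential. -/
def potentialNorm (q : ℝ → ℝ) : ℝ := √(∫ s in (0 : ℝ)..Real.pi, q s ^ 2)

lemma IsSquareIntegrable.sqrt_integral_sq_le (hq : IsSquareIntegrable q) {x : ℝ}
    (hx : x ∈ Icc 0 Real.pi) : √(∫ s in (0 : ℝ)..x, q s ^ 2) ≤ potentialNorm q := by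
  refine Real.sqrt_le_sqrt ?_
  have hpi := Real.pi_pos.le
  rw [integral_of_le hx.1, integral_of_le hpi]
  exact setIntegral_mono_set (hq.memLp_Ioc ⟨hpi, le_rfl⟩).integrable_sq
    (Eventually.of_forall fun s => sq_nonneg _) (Ioc_subset_Ioc_right hx.2).eventuallyLE

lemma memLp_Ioc_of_continuous {F : Type*} [NormedAddCommGroup F] {g : ℝ → F} (hg : Continuous g)
    (x : ℝ) : MemLp g 2 (volume.restrict (Ioc 0 x)) := by
  obtain ⟨C, hC⟩ := isCompact_Icc.exists_bound_of_continuousOn (s := Icc 0 x) hg.continuousOn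
  exact MemLp.of_bound hg.aestronglyMeasurable C
    ((ae_restrict_mem measurableSet_Ioc).mono fun s hs => hC s (Ioc_subset_Icc_self hs))

/-- With the weight `exp (L x)`, the Volterra operator with kernel `B |q|` has norm at most
`1 / 2`. -/
lemma IsSquareIntegrable.exists_weight (hq : IsSquareIntegrable q) {B : ℝ} (hB : 0 ≤ B) :
    ∃ L : ℝ, 0 < L ∧ ∀ x ∈ Icc 0 Real.pi,
      B * ∫ s in (0 : ℝ)..x, |q s| * Real.exp (L * s) ≤ Real.exp (L * x) / 2 := by
  set N := potentialNorm q
  have hN : 0 ≤ N := Real.sqrt_nonneg _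
  -- By Cauchy–Schwarz the left-hand side is at most `B N / √(2 L)` times the exponential, and
  -- `2 L ≥ (2 B N)²` makes this factor at most `1 / 2`.
  refine ⟨2 * (B * N) ^ 2 + 1, by positivity, fun x hx => ?_⟩
  set L := 2 * (B * N) ^ 2 + 1
  have hL : 0 < L := by positivity
  have h1 := integral_abs_mul_le hx.1 (hq.memLp_Ioc hx)
    (memLp_Ioc_of_continuous (g := fun s => Real.exp (L * s)) (by fun_prop) x)
  have h2 : ∫ s in (0 : ℝ)..x, Real.exp (L * s) ^ 2 ≤ Real.exp (L * x) ^ 2 / (2 * L) := by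
    have e : ∀ s : ℝ, Real.exp (L * s) ^ 2 = Real.exp ((2 * L) * s) := fun s => by
      rw [← Real.exp_nat_mul]; push_cast; ring_nf
    simp_rw [e]
    rw [integral_comp_mul_left (fun s => Real.exp s) (by positivity), integral_exp, smul_eq_mul,
      inv_mul_eq_div]
    gcongr
    simp
  have h3 : √(∫ s in (0 : ℝ)..x, Real.exp (L * s) ^ 2) ≤ Real.exp (L * x) / √(2 * L) := by
    refine (Real.sqrt_le_sqrt h2).trans ?_
    rw [Real.sqrt_div (by positivity), Real.sqrt_sq (Real.exp_pos _).le]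
  have h4 : 2 * (B * N) ≤ √(2 * L) := by
    refine Real.le_sqrt_of_sq_le ?_
    simp only [L]; nlinarith
  have h5 : 0 < √(2 * L) := Real.sqrt_pos.2 (by positivity)
  simp only [Real.abs_exp] at h1
  calc B * ∫ s in (0 : ℝ)..x, |q s| * Real.exp (L * s)
      ≤ B * (N * (Real.exp (L * x) / √(2 * L))) := by
        refine mul_le_mul_of_nonneg_left (h1.trans ?_) hB
        exact mul_le_mul (hq.sqrt_integral_sq_le hx) h3 (Real.sqrt_nonneg _) hN
    _ = (B * N) / √(2 * L) * Real.exp (L * x) := by ring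
    _ ≤ (1 / 2) * Real.exp (L * x) := by
        refine mul_le_mul_of_nonneg_right ?_ (Real.exp_pos _).le
        rw [div_le_div_iff₀ h5 two_pos]
        linarith
    _ = _ := by ring

/-- If every bound `d ≤ M w` improves to `d ≤ (C + M / 2) w` and some such bound holds, then
`d ≤ 2 C w`, independently of the bound at the start. This is how the weighted Volterra estimates
are used. -/
lemma le_of_bound_improves {X : Type*} {d w : X → ℝ} {C : ℝ}
    (hw : ∀ p, 0 < w p) (hbdd : ∃ M, 0 ≤ M ∧ ∀ p, d p ≤ M * w p)
    (hC : 0 ≤ C) (step : ∀ M, 0 ≤ M → (∀ p, d p ≤ M * w p) → ∀ p, d p ≤ (C + M / 2) * w p) (p : X) :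
    d p ≤ 2 * C * w p := by
  obtain ⟨M, hM, h⟩ := hbdd
  have key : ∀ k : ℕ, ∀ p, d p ≤ (2 * C + M * (1 / 2) ^ k) * w p := by
    intro k
    induction k with
    | zero =>
      intro p
      refine (h p).trans (mul_le_mul_of_nonneg_right ?_ (hw p).le)
      linarith
    | succ k ih =>
      intro p
      refine (step _ (by positivity) ih p).trans_eq ?_
      rw [pow_succ]
      ring
  refine ge_of_tendsto' (x := atTop) ?_ fun k => key k p
  have : Tendsto (fun k : ℕ => (2 * C + M * (1 / 2 : ℝ) ^ k) * w p) atTop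
      (𝓝 ((2 * C + M * 0) * w p)) :=
    ((tendsto_const_nhds.mul (tendsto_pow_atTop_nhds_zero_of_lt_one (by norm_num)
      (by norm_num))).const_add _).mul_const _
  simpa using this

end Potential

section Solutions

variable {q : ℝ → ℝ} {y dy z dz : ℝ → ℂ} {lam mu : ℂ}

lemma IsSolution.continuousOn (hy : IsSolution q lam y dy) : ContinuousOn y (Icc 0 Real.pi) :=
  fun x hx => (hy.1 x hx).continuousWithinAt

lemma IsSolution.intervalIntegrable (hq : IsSquareIntegrable q) (hy : IsSolution q lam y dy)
    {x : ℝ} (hx : x ∈ Icc 0 Real.pi) :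
    IntervalIntegrable (fun t => ((q t : ℂ) - lam) * y t) volume 0 x := by
  refine ((hq.intervalIntegrable_ofReal hx).sub
    (_root_.intervalIntegrable_const)).mul_continuousOn ?_
  rw [uIcc_of_le hx.1]
  exact hy.continuousOn.mono (Icc_subset_Icc_right hx.2)

lemma IsSolution.continuousOn_deriv (hq : IsSquareIntegrable q) (hy : IsSolution q lam y dy) :
    ContinuousOn dy (Icc 0 Real.pi) := by
  have hpi := Real.pi_pos.le
  have h := hy.intervalIntegrable hq (right_mem_Icc.2 hpi)
  rw [← uIcc_of_le hpi]
  refine ((continuousOn_primitive_interval' h left_mem_uIcc).const_add (dy 0)).congr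
    fun x hx => hy.2 x (by rwa [uIcc_of_le hpi] at hx)

lemma IsSolution.eq_add_integral (hq : IsSquareIntegrable q) (hy : IsSolution q lam y dy)
    {x : ℝ} (hx : x ∈ Icc 0 Real.pi) : y x = y 0 + ∫ t in (0 : ℝ)..x, dy t := by
  rw [integral_eq_sub_of_hasDerivAt_of_le hx.1 (hy.continuousOn.mono (Icc_subset_Icc_right hx.2))
    (fun t ht => (hy.1 t ⟨ht.1.le, ht.2.le.trans hx.2⟩).hasDerivAt
      (Icc_mem_nhds ht.1 (ht.2.trans_le hx.2)))]
  · ring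
  · refine ContinuousOn.intervalIntegrable ?_
    rw [uIcc_of_le hx.1]
    exact (hy.continuousOn_deriv hq).mono (Icc_subset_Icc_right hx.2)

lemma IsSolution.intervalIntegrable_deriv (hq : IsSquareIntegrable q) (hy : IsSolution q lam y dy)
    {x : ℝ} (hx : x ∈ Icc 0 Real.pi) : IntervalIntegrable dy volume 0 x := by
  refine ContinuousOn.intervalIntegrable ?_
  rw [uIcc_of_le hx.1]
  exact (hy.continuousOn_deriv hq).mono (Icc_subset_Icc_right hx.2)

/-- The Wronskian identity. The derivatives are only absolutely continuous, so it comes from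
integration by parts rather than from differentiating the Wronskian. -/
lemma IsSolution.wronskian (hq : IsSquareIntegrable q) (hy : IsSolution q lam y dy)
    (hz : IsSolution q mu z dz) :
    (y Real.pi * dz Real.pi - dy Real.pi * z Real.pi) - (y 0 * dz 0 - dy 0 * z 0) =
      (lam - mu) * ∫ t in (0 : ℝ)..Real.pi, y t * z t := by
  have hpi : Real.pi ∈ Icc 0 Real.pi := right_mem_Icc.2 Real.pi_pos.le
  have h1 := integral_deriv_mul_of_eq_integral Real.pi_pos.le (hy.intervalIntegrable_deriv hq hpi)
    (hz.intervalIntegrable hq hpi) (fun x hx => hy.eq_add_integral hq hx) hz.2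
  have h2 := integral_deriv_mul_of_eq_integral Real.pi_pos.le (hy.intervalIntegrable hq hpi)
    (hz.intervalIntegrable_deriv hq hpi) hy.2 (fun x hx => hz.eq_add_integral hq hx)
  have huI : uIcc 0 Real.pi = Icc 0 Real.pi := uIcc_of_le Real.pi_pos.le
  have i1 : IntervalIntegrable (fun t => dy t * dz t + y t * (((q t : ℂ) - mu) * z t)) volume
      0 Real.pi :=
    ((hy.intervalIntegrable_deriv hq hpi).mul_continuousOn
      (by rw [huI]; exact hz.continuousOn_deriv hq)).add
      ((hz.intervalIntegrable hq hpi).continuousOn_mul (by rw [huI]; exact hy.continuousOn))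
  have i2 : IntervalIntegrable (fun t => ((q t : ℂ) - lam) * y t * z t + dy t * dz t) volume
      0 Real.pi :=
    ((hy.intervalIntegrable hq hpi).mul_continuousOn
      (by rw [huI]; exact hz.continuousOn)).add
      ((hz.intervalIntegrable_deriv hq hpi).continuousOn_mul
        (by rw [huI]; exact hy.continuousOn_deriv hq))
  rw [← intervalIntegral.integral_const_mul]
  have h3 := integral_sub i1 i2
  rw [h1, h2] at h3
  refine Eq.trans ?_ (h3.symm.trans (integral_congr fun t _ => ?_))
  · ring
  · ring

/-- Variation of constants, for an arbitrary solution `S` of `S'' = -lam S`. With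
`S = sin (ρ t) / ρ` and `S = cos (ρ t)` this gives the integral equations for `y` and for `y'`. -/
lemma IsSolution.duhamel (hq : IsSquareIntegrable q) (hy : IsSolution q lam y dy)
    {S S' : ℝ → ℂ} (hS : ∀ t, HasDerivAt S (S' t) t) (hS' : ∀ t, HasDerivAt S' (-lam * S t) t)
    {x : ℝ} (hx : x ∈ Icc 0 Real.pi) :
    S 0 * dy x + S' 0 * y x =
      S x * dy 0 + S' x * y 0 + ∫ s in (0 : ℝ)..x, S (x - s) * (q s * y s) := by
  have cS : Continuous S := continuous_iff_continuousAt.2 fun t => (hS t).continuousAt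
  have cS' : Continuous S' := continuous_iff_continuousAt.2 fun t => (hS' t).continuousAt
  have hsub : Icc 0 x ⊆ Icc 0 Real.pi := Icc_subset_Icc_right hx.2
  have d1 : ∀ s, HasDerivAt (fun s => S (x - s)) (-S' (x - s)) s := fun s =>
    (hS (x - s)).comp_const_sub x s
  have d2 : ∀ s, HasDerivAt (fun s => S' (x - s)) (lam * S (x - s)) s := fun s => by
    have := (hS' (x - s)).comp_const_sub x s
    simpa using this
  have h1 := integral_deriv_mul_of_hasDerivAt_left hx.1 d1 (by fun_prop)
    (hy.intervalIntegrable hq hx) (fun t ht => hy.2 t (hsub ht))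
  have h2 := integral_deriv_mul_of_hasDerivAt_left hx.1 d2 (by fun_prop)
    (hy.intervalIntegrable_deriv hq hx) (fun t ht => hy.eq_add_integral hq (hsub ht))
  have i1 : IntervalIntegrable (fun t => -S' (x - t) * dy t + S (x - t) * (((q t : ℂ) - lam) * y t))
      volume 0 x :=
    ((hy.intervalIntegrable_deriv hq hx).continuousOn_mul (by fun_prop)).add
      ((hy.intervalIntegrable hq hx).continuousOn_mul (by fun_prop))
  have cy : IntervalIntegrable y volume 0 x := by
    refine ContinuousOn.intervalIntegrable ?_
    rw [uIcc_of_le hx.1]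
    exact hy.continuousOn.mono hsub
  have i2 : IntervalIntegrable (fun t => lam * S (x - t) * y t + S' (x - t) * dy t) volume 0 x :=
    (cy.continuousOn_mul (by fun_prop)).add
      ((hy.intervalIntegrable_deriv hq hx).continuousOn_mul (by fun_prop))
  have h3 := integral_add i1 i2
  rw [h1, h2] at h3
  have h4 : ∫ s in (0 : ℝ)..x, S (x - s) * (q s * y s) =
      S (x - x) * dy x - S (x - 0) * dy 0 + (S' (x - x) * y x - S' (x - 0) * y 0) := by
    rw [← h3]
    exact integral_congr fun t _ => by ring
  rw [h4]
  simp only [sub_self, sub_zero]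
  ring

/-- `sin (ρ t) / ρ`, continued to `ρ = 0`. -/
def sineKernel (ρ : ℂ) (t : ℝ) : ℂ := ∫ u in (0 : ℝ)..t, Complex.cos (ρ * u)

lemma hasDerivAt_sineKernel (ρ : ℂ) (t : ℝ) :
    HasDerivAt (sineKernel ρ) (Complex.cos (ρ * t)) t :=
  (Continuous.integral_hasStrictDerivAt (f := fun u : ℝ => Complex.cos (ρ * u))
    (by fun_prop) 0 t).hasDerivAt

lemma mul_sineKernel (ρ : ℂ) (t : ℝ) : ρ * sineKernel ρ t = Complex.sin (ρ * t) := by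
  rcases eq_or_ne ρ 0 with rfl | h
  · simp
  · rw [sineKernel, integral_cos_mul_complex h]
    field_simp
    simp

lemma hasDerivAt_cos_mul (ρ : ℂ) (t : ℝ) :
    HasDerivAt (fun t : ℝ => Complex.cos (ρ * t)) (-ρ * Complex.sin (ρ * t)) t := by
  have h1 : HasDerivAt (fun t : ℝ => ρ * (t : ℂ)) ρ t := by
    simpa using (Complex.ofRealCLM.hasDerivAt (x := t)).const_mul ρ
  exact ((Complex.hasDerivAt_cos _).comp t h1).congr_deriv (by ring)

lemma IsSolution.eq_sineKernel {ρ : ℂ} (hq : IsSquareIntegrable q)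
    (hy : IsSolution q (ρ ^ 2) y dy) {x : ℝ} (hx : x ∈ Icc 0 Real.pi) :
    y x = Complex.cos (ρ * x) * y 0 + sineKernel ρ x * dy 0 +
      ∫ s in (0 : ℝ)..x, sineKernel ρ (x - s) * (q s * y s) := by
  have h := hy.duhamel hq (hasDerivAt_sineKernel ρ) (S' := fun t : ℝ => Complex.cos (ρ * t))
    (fun t => (hasDerivAt_cos_mul ρ t).congr_deriv (by rw [← mul_sineKernel]; ring)) hx
  simp only [Complex.ofReal_zero, mul_zero, Complex.cos_zero, one_mul] at h
  rw [show sineKernel ρ 0 = 0 by simp [sineKernel], zero_mul, zero_add] at h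
  rw [h]
  ring

lemma IsSolution.deriv_eq_cos {ρ : ℂ} (hq : IsSquareIntegrable q)
    (hy : IsSolution q (ρ ^ 2) y dy) {x : ℝ} (hx : x ∈ Icc 0 Real.pi) :
    dy x = Complex.cos (ρ * x) * dy 0 - ρ * Complex.sin (ρ * x) * y 0 +
      ∫ s in (0 : ℝ)..x, Complex.cos (ρ * (x - s)) * (q s * y s) := by
  have hd : ∀ t : ℝ, HasDerivAt (fun t : ℝ => -ρ * Complex.sin (ρ * t))
      (-ρ ^ 2 * Complex.cos (ρ * t)) t := fun t => by
    have h1 : HasDerivAt (fun t : ℝ => ρ * (t : ℂ)) ρ t := by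
      simpa using (Complex.ofRealCLM.hasDerivAt (x := t)).const_mul ρ
    exact (((Complex.hasDerivAt_sin _).comp t h1).const_mul (-ρ)).congr_deriv (by ring)
  have h := hy.duhamel hq (hasDerivAt_cos_mul ρ) hd hx
  simp only [Complex.ofReal_zero, mul_zero, Complex.cos_zero, one_mul, Complex.sin_zero,
    zero_mul, add_zero, Complex.ofReal_sub] at h
  rw [h]
  ring

lemma IsSolution.sub_mul (hq : IsSquareIntegrable q) (hy : IsSolution q lam y dy)
    (hz : IsSolution q lam z dz) (c : ℂ) :
    IsSolution q lam (fun x => y x - c * z x) (fun x => dy x - c * dz x) := by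
  refine ⟨fun x hx => (hy.1 x hx).sub ((hz.1 x hx).const_mul c), fun x hx => ?_⟩
  have h : ∫ t in (0 : ℝ)..x, ((q t : ℂ) - lam) * (y t - c * z t) =
      (∫ t in (0 : ℝ)..x, ((q t : ℂ) - lam) * y t) -
        c * ∫ t in (0 : ℝ)..x, ((q t : ℂ) - lam) * z t := by
    rw [← intervalIntegral.integral_const_mul, ← integral_sub (hy.intervalIntegrable hq hx)
      ((hz.intervalIntegrable hq hx).const_mul c)]
    exact integral_congr fun t _ => by ring
  simp only [h]
  rw [hy.2 x hx, hz.2 x hx]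
  ring

lemma IsSolution.conj {ρ : ℂ} (hy : IsSolution q (ρ ^ 2) y dy) :
    IsSolution q ((starRingEnd ℂ ρ) ^ 2) (fun x => starRingEnd ℂ (y x))
      (fun x => starRingEnd ℂ (dy x)) := by
  refine ⟨fun x hx => ?_, fun x hx => ?_⟩
  · exact (Complex.conjCLE.toContinuousLinearMap.hasFDerivAt.comp_hasDerivWithinAt x (hy.1 x hx))
  · change starRingEnd ℂ (dy x) = _
    rw [hy.2 x hx, map_add, integral_of_le hx.1, integral_of_le hx.1, ← integral_conj]
    simp

/-- A solution is determined by its initial data: with vanishing data, the integral equation for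
`y` is homogeneous and its Volterra operator is a contraction in a weighted norm. -/
lemma IsSolution.eq_zero {ρ : ℂ} (hq : IsSquareIntegrable q)
    (hy : IsSolution q (ρ ^ 2) y dy) (h0 : y 0 = 0) (hd0 : dy 0 = 0) {x : ℝ}
    (hx : x ∈ Icc 0 Real.pi) : y x = 0 ∧ dy x = 0 := by
  have cS : Continuous (sineKernel ρ) :=
    continuous_iff_continuousAt.2 fun t => (hasDerivAt_sineKernel ρ t).continuousAt
  obtain ⟨B, hB⟩ := isCompact_Icc.exists_bound_of_continuousOn (s := Icc 0 Real.pi) cS.continuousOn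
  have hB0 : 0 ≤ B := (norm_nonneg _).trans (hB 0 (left_mem_Icc.2 Real.pi_pos.le))
  obtain ⟨M, hM⟩ := isCompact_Icc.exists_bound_of_continuousOn hy.continuousOn
  obtain ⟨L, hL, hw⟩ := hq.exists_weight hB0
  have key : ∀ p : Icc 0 Real.pi, ‖y p‖ ≤ 2 * 0 * Real.exp (L * p) := by
    refine le_of_bound_improves (d := fun p : Icc 0 Real.pi => ‖y p‖)
      (w := fun p : Icc 0 Real.pi => Real.exp (L * p)) (fun p => Real.exp_pos _)
      ⟨|M|, abs_nonneg _, fun p => ?_⟩ le_rfl ?_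
    · have : 1 ≤ Real.exp (L * p) := Real.one_le_exp (mul_nonneg hL.le p.2.1)
      calc ‖y p‖ ≤ M := hM p p.2
        _ ≤ |M| * 1 := by rw [mul_one]; exact le_abs_self M
        _ ≤ _ := by gcongr
    · intro K hK h p
      have e := hy.eq_sineKernel hq p.2
      rw [h0, hd0, mul_zero, mul_zero, zero_add, zero_add] at e
      change ‖y p‖ ≤ _
      rw [e]
      have hqi := ((hq.intervalIntegrable p.2).abs.mul_continuousOn
          (g := fun s => Real.exp (L * s)) (by fun_prop)).const_mul (B * K)
      refine (norm_integral_le_of_norm_le p.2.1 (g := fun s =>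
        (B * K) * (|q s| * Real.exp (L * s))) (Eventually.of_forall fun s hs => ?_) hqi).trans ?_
      · rw [norm_mul, norm_mul, Complex.norm_real, Real.norm_eq_abs]
        have hs' : s ∈ Icc 0 Real.pi := ⟨hs.1.le, hs.2.trans p.2.2⟩
        have h1 := hB (p - s) ⟨by linarith [hs.2], by linarith [hs.1, p.2.2]⟩
        have h2 := h ⟨s, hs'⟩
        simp only at h2
        calc ‖sineKernel ρ (p - s)‖ * (|q s| * ‖y s‖)
            ≤ B * (|q s| * (K * Real.exp (L * s))) := by gcongr
          _ = _ := by ring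
      · rw [intervalIntegral.integral_const_mul]
        have := hw p p.2
        calc B * K * ∫ s in (0 : ℝ)..p, |q s| * Real.exp (L * s)
            = K * (B * ∫ s in (0 : ℝ)..p, |q s| * Real.exp (L * s)) := by ring
          _ ≤ K * (Real.exp (L * p) / 2) := by gcongr
          _ = _ := by ring
  have hz : ∀ s ∈ Icc 0 Real.pi, y s = 0 := fun s hs => by
    have := key ⟨s, hs⟩
    simpa using this
  refine ⟨hz x hx, ?_⟩
  have e := hy.deriv_eq_cos hq hx
  rw [h0, hd0, mul_zero, mul_zero, sub_zero, zero_add] at e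
  rw [e]
  refine integral_zero_ae (Eventually.of_forall fun s hs => ?_)
  rw [uIoc_of_le hx.1] at hs
  rw [hz s ⟨hs.1.le, hs.2.trans hx.2⟩, mul_zero, mul_zero]

end Solutions

end Equation

/-! ### An estimate for the wave equation `w_xx - q(x) w = w_yy` -/

section WaveEstimate

open MeasureTheory Filter Topology Set intervalIntegral

/-- The addition theorem `2 sin (ρ a) cos (ρ y) = sin (ρ (y + a)) - sin (ρ (y - a))`, in the form
that passes from a single solution to a solution of the wave equation. -/
lemma sineKernel_mul_cos (ρ : ℂ) (a y : ℝ) :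
    sineKernel ρ a * Complex.cos (ρ * y) =
      (∫ t in (y - a)..(y + a), Complex.cos (ρ * t)) / 2 := by
  have hi : ∀ a b : ℝ, IntervalIntegrable (fun t : ℝ => Complex.cos (ρ * t)) volume a b :=
    fun a b => Continuous.intervalIntegrable (by fun_prop) _ _
  rcases eq_or_ne ρ 0 with rfl | h
  · simp [sineKernel]
  · rw [sineKernel, integral_cos_mul_complex h, integral_cos_mul_complex h]
    push_cast
    rw [mul_add, mul_sub, Complex.sin_add, Complex.sin_sub]
    simp
    ring

/-- The cosine polynomial `y ↦ ∑ c_ρ cos (ρ y)` with finitely many complex frequencies `ρ`. -/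
def cosPoly (c : ℂ →₀ ℂ) (y : ℝ) : ℂ := ∑ ρ ∈ c.support, c ρ * Complex.cos (ρ * y)

lemma continuous_cosPoly (c : ℂ →₀ ℂ) : Continuous (cosPoly c) := by
  unfold cosPoly; fun_prop

lemma cosPoly_neg (c : ℂ →₀ ℂ) (y : ℝ) : cosPoly c (-y) = cosPoly c y := by
  simp [cosPoly]

/-- The `L²(0, x)` norm of a cosine polynomial. -/
def cosPolyNorm (c : ℂ →₀ ℂ) (x : ℝ) : ℝ := √(∫ t in (0 : ℝ)..x, ‖cosPoly c t‖ ^ 2)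

lemma integral_neg_self_of_even {f : ℝ → ℝ} (hf : Continuous f) (he : ∀ t, f (-t) = f t) (x : ℝ) :
    ∫ t in (-x)..x, f t = 2 * ∫ t in (0 : ℝ)..x, f t := by
  rw [← integral_add_adjacent_intervals (hf.intervalIntegrable (-x) 0)
    (hf.intervalIntegrable 0 x)]
  have h := integral_comp_neg (a := 0) (b := x) f
  simp only [he, neg_zero] at h
  rw [← h]
  ring

lemma integral_norm_cosPoly_le (c : ℂ →₀ ℂ) {x : ℝ} (hx : x ∈ Icc 0 Real.pi) :
    ∫ t in (-x)..x, ‖cosPoly c t‖ ≤ 2 * √Real.pi * cosPolyNorm c x := by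
  have hc := continuous_cosPoly c
  rw [integral_neg_self_of_even hc.norm (fun t => by rw [cosPoly_neg]), mul_assoc]
  have h := integral_abs_mul_le hx.1
    (memLp_Ioc_of_continuous (g := fun _ => (1 : ℝ)) continuous_const x)
    (memLp_Ioc_of_continuous hc.norm x)
  simp only [abs_one, one_mul, abs_norm, one_pow, intervalIntegral.integral_const, sub_zero,
    smul_eq_mul, mul_one] at h
  have := Real.sqrt_le_sqrt hx.2
  refine mul_le_mul_of_nonneg_left (h.trans ?_) two_pos.le
  exact mul_le_mul_of_nonneg_right this (Real.sqrt_nonneg _)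

lemma norm_integral_cosPoly_le (c : ℂ →₀ ℂ) {x a b : ℝ} (ha : -x ≤ a) (hab : a ≤ b)
    (hb : b ≤ x) : ‖∫ t in a..b, cosPoly c t‖ ≤ ∫ t in (-x)..x, ‖cosPoly c t‖ :=
  (intervalIntegral.norm_integral_le_integral_norm hab).trans
    (integral_mono_interval ha hab hb (Eventually.of_forall fun _ => norm_nonneg _)
      ((continuous_cosPoly c).norm.intervalIntegrable _ _))

section Wave

variable {q : ℝ → ℝ} {h : ℝ} {φ dφ : ℂ → ℝ → ℂ}

/-- The solution `∑ c_ρ φ(ρ, x) cos (ρ y)` of the wave equation `w_xx - q(x) w = w_yy`. -/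
def wave (φ : ℂ → ℝ → ℂ) (c : ℂ →₀ ℂ) (x y : ℝ) : ℂ :=
  ∑ ρ ∈ c.support, c ρ * (φ ρ x * Complex.cos (ρ * y))

/-- The difference of `wave` and the solution `(u(y + x) + u(y - x)) / 2` of the free wave equation
with the same value at `x = 0`. -/
def waveDiff (φ : ℂ → ℝ → ℂ) (c : ℂ →₀ ℂ) (x y : ℝ) : ℂ :=
  wave φ c x y - (cosPoly c (y + x) + cosPoly c (y - x)) / 2

lemma waveDiff_eq_sum (φ : ℂ → ℝ → ℂ) (c : ℂ →₀ ℂ) (x y : ℝ) : waveDiff φ c x y =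
    ∑ ρ ∈ c.support, c ρ * (φ ρ x * Complex.cos (ρ * y) -
      Complex.cos (ρ * x) * Complex.cos (ρ * y)) := by
  rw [waveDiff, wave, cosPoly, cosPoly, ← Finset.sum_add_distrib, Finset.sum_div,
    ← Finset.sum_sub_distrib]
  refine Finset.sum_congr rfl fun ρ _ => ?_
  push_cast
  rw [mul_add, mul_sub, Complex.cos_add, Complex.cos_sub]
  ring

lemma IsPhi.continuousOn (hφ : IsPhi q h φ dφ) (ρ : ℂ) : ContinuousOn (φ ρ) (Icc 0 Real.pi) :=
  (hφ ρ).1.continuousOn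

/-- Duhamel's formula for the wave equation. -/
lemma IsPhi.waveDiff_eq (hq : IsSquareIntegrable q) (hφ : IsPhi q h φ dφ) (c : ℂ →₀ ℂ) {x : ℝ}
    (hx : x ∈ Icc 0 Real.pi) (y : ℝ) : waveDiff φ c x y =
      h / 2 * (∫ t in (y - x)..(y + x), cosPoly c t) +
        ∫ s in (0 : ℝ)..x, q s * ((∫ t in (y - (x - s))..(y + (x - s)), wave φ c s t) / 2) := by
  have e1 : ∀ a b : ℝ, ∫ t in a..b, cosPoly c t =
      ∑ ρ ∈ c.support, c ρ * ∫ t in a..b, Complex.cos (ρ * t) := by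
    intro a b
    simp_rw [cosPoly]
    rw [intervalIntegral.integral_finsetSum fun ρ _ =>
      Continuous.intervalIntegrable (by fun_prop) _ _]
    simp
  have e2 : ∀ s a b : ℝ, ∫ t in a..b, wave φ c s t =
      ∑ ρ ∈ c.support, c ρ * (φ ρ s * ∫ t in a..b, Complex.cos (ρ * t)) := by
    intro s a b
    simp_rw [wave]
    rw [intervalIntegral.integral_finsetSum fun ρ _ =>
      Continuous.intervalIntegrable (by fun_prop) _ _]
    simp
  have e3 : ∫ s in (0 : ℝ)..x, q s * ((∫ t in (y - (x - s))..(y + (x - s)), wave φ c s t) / 2) =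
      ∑ ρ ∈ c.support, c ρ * (Complex.cos (ρ * y) *
        ∫ s in (0 : ℝ)..x, sineKernel ρ (x - s) * (q s * φ ρ s)) := by
    have e4 : ∀ s : ℝ, (q s : ℂ) * ((∫ t in (y - (x - s))..(y + (x - s)), wave φ c s t) / 2) =
        ∑ ρ ∈ c.support, c ρ * (Complex.cos (ρ * y) * (sineKernel ρ (x - s) * (q s * φ ρ s))) := by
      intro s
      rw [e2, Finset.sum_div, Finset.mul_sum]
      refine Finset.sum_congr rfl fun ρ _ => ?_
      have := sineKernel_mul_cos ρ (x - s) y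
      linear_combination (-(c ρ) * q s * φ ρ s) * this
    simp_rw [e4]
    rw [intervalIntegral.integral_finsetSum fun ρ _ => ?_]
    · simp only [intervalIntegral.integral_const_mul]
    · have cS : Continuous (sineKernel ρ) :=
        continuous_iff_continuousAt.2 fun t => (hasDerivAt_sineKernel ρ t).continuousAt
      refine (((((hq.intervalIntegrable_ofReal hx).mul_continuousOn ?_)).continuousOn_mul
        (g := fun s => sineKernel ρ (x - s)) (by fun_prop)).const_mul _).const_mul _
      rw [uIcc_of_le hx.1]
      exact (hφ.continuousOn ρ).mono (Icc_subset_Icc_right hx.2)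
  rw [waveDiff_eq_sum, e1, e3, Finset.mul_sum, ← Finset.sum_add_distrib]
  refine Finset.sum_congr rfl fun ρ _ => ?_
  have k1 := (hφ ρ).1.eq_sineKernel hq hx
  rw [(hφ ρ).2.1, (hφ ρ).2.2] at k1
  rw [k1]
  have := sineKernel_mul_cos ρ x y
  linear_combination (c ρ * h) * this

/-- On the triangle `|y| ≤ x₀ - x`, the `L²(0, x₀)` norm of the data controls `waveDiff`. In
Duhamel's formula the domains of dependence stay in the triangle, so the supremum of `waveDiff`
over it, weighted with `exp (L x)`, is bounded by the data and half of itself. The constant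
depends neither on `x₀` nor on the frequencies. -/
lemma IsPhi.exists_norm_waveDiff_le (hq : IsSquareIntegrable q) (hφ : IsPhi q h φ dφ) :
    ∃ C : ℝ, 0 ≤ C ∧ ∀ (c : ℂ →₀ ℂ), ∀ x₀ ∈ Icc 0 Real.pi, ∀ x y : ℝ, 0 ≤ x → |y| ≤ x₀ - x →
      ‖waveDiff φ c x y‖ ≤ C * cosPolyNorm c x₀ := by
  obtain ⟨L, hL, hw⟩ := hq.exists_weight Real.pi_pos.le
  have hpi : Real.pi ∈ Icc 0 Real.pi := right_mem_Icc.2 Real.pi_pos.le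
  set Q := ∫ s in (0 : ℝ)..Real.pi, |q s| with hQdef
  have hQ : 0 ≤ Q := integral_nonneg Real.pi_pos.le fun _ _ => abs_nonneg _
  refine ⟨(|h| + Q) * (2 * √Real.pi) * Real.exp (L * Real.pi), by positivity,
    fun c x₀ hx₀ x y hx hy => ?_⟩
  set A := ∫ t in (-x₀)..x₀, ‖cosPoly c t‖ with hAdef
  have hA0 : 0 ≤ A := integral_nonneg (by linarith [hx₀.1]) fun _ _ => norm_nonneg _
  -- the characteristic triangle
  let X := {p : ℝ × ℝ // 0 ≤ p.1 ∧ |p.2| ≤ x₀ - p.1}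
  have hX : ∀ p : X, p.1.1 ∈ Icc 0 Real.pi := fun p =>
    ⟨p.2.1, by linarith [p.2.2, abs_nonneg p.1.2, hx₀.2]⟩
  have hbdd : ∃ M, 0 ≤ M ∧ ∀ p : X, ‖waveDiff φ c p.1.1 p.1.2‖ ≤ M * Real.exp (L * p.1.1) := by
    have hcont : ContinuousOn (fun p : ℝ × ℝ => waveDiff φ c p.1 p.2)
        (Icc 0 Real.pi ×ˢ Icc (-Real.pi) Real.pi) := by
      simp_rw [waveDiff_eq_sum]
      refine continuousOn_finsetSum _ fun ρ _ => ?_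
      have h1 : ContinuousOn (fun p : ℝ × ℝ => φ ρ p.1) (Icc 0 Real.pi ×ˢ Icc (-Real.pi) Real.pi) :=
        (hφ.continuousOn ρ).comp continuousOn_fst fun p hp => hp.1
      exact continuousOn_const.mul ((h1.mul (Continuous.continuousOn (by fun_prop))).sub
        (Continuous.continuousOn (by fun_prop)))
    obtain ⟨M, hM⟩ := (isCompact_Icc.prod isCompact_Icc).exists_bound_of_continuousOn hcont
    refine ⟨|M|, abs_nonneg _, fun p => ?_⟩
    have hp := abs_le.1 p.2.2
    have h1 : 1 ≤ Real.exp (L * p.1.1) := Real.one_le_exp (mul_nonneg hL.le p.2.1)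
    calc ‖waveDiff φ c p.1.1 p.1.2‖ ≤ M := hM p.1 ⟨hX p, by
          constructor <;> linarith [hp.1, hp.2, p.2.1, hx₀.2]⟩
      _ ≤ |M| * 1 := by rw [mul_one]; exact le_abs_self M
      _ ≤ _ := by gcongr
  have key := le_of_bound_improves (X := X) (d := fun p => ‖waveDiff φ c p.1.1 p.1.2‖)
    (w := fun p => Real.exp (L * p.1.1)) (C := (|h| + Q) / 2 * A) (fun p => Real.exp_pos _) hbdd
    (by positivity) (fun K hK hd p => by
      obtain ⟨⟨x, y⟩, hx, hy⟩ := p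
      simp only at hx hy ⊢
      have hxpi : x ∈ Icc 0 Real.pi := hX ⟨(x, y), hx, hy⟩
      have hy' := abs_le.1 hy
      rw [hφ.waveDiff_eq hq c hxpi y]
      have hinner : ∀ s ∈ Ioc 0 x, ‖∫ t in (y - (x - s))..(y + (x - s)), wave φ c s t‖ ≤
          A + 2 * Real.pi * (K * Real.exp (L * s)) := by
        intro s hs
        have hcD : Continuous fun t => waveDiff φ c s t := by
          simp_rw [waveDiff_eq_sum]; fun_prop
        have hcU := continuous_cosPoly c
        have e : ∀ t, wave φ c s t =
            waveDiff φ c s t + (cosPoly c (t + s) + cosPoly c (t - s)) / 2 :=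
          fun t => by rw [waveDiff]; ring
        simp_rw [e]
        rw [integral_add (hcD.intervalIntegrable _ _)
          (Continuous.intervalIntegrable (by fun_prop) _ _), intervalIntegral.integral_div,
          integral_add (Continuous.intervalIntegrable (by fun_prop) _ _)
          (Continuous.intervalIntegrable (by fun_prop) _ _), integral_comp_add_right,
          integral_comp_sub_right, add_comm A]
        have hs2 := hs.2
        have hs1 := hs.1
        refine (norm_add_le _ _).trans (add_le_add ?_ ?_)
        · refine (intervalIntegral.norm_integral_le_of_norm_le_const
            (C := K * Real.exp (L * s)) ?_).trans ?_
          · intro t ht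
            rw [uIoc_of_le (by linarith)] at ht
            exact hd ⟨(s, t), hs.1.le, abs_le.2
              ⟨by simp only; linarith [ht.1], by simp only; linarith [ht.2]⟩⟩
          · rw [mul_comm]
            gcongr
            rw [abs_of_nonneg (by linarith)]
            linarith [hxpi.2]
        · rw [norm_div, Complex.norm_ofNat, div_le_iff₀ two_pos]
          refine (norm_add_le _ _).trans ?_
          have b1 := norm_integral_cosPoly_le c (x := x₀) (a := y - (x - s) + s)
            (b := y + (x - s) + s) (by linarith) (by linarith) (by linarith)
          have b2 := norm_integral_cosPoly_le c (x := x₀) (a := y - (x - s) - s)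
            (b := y + (x - s) - s) (by linarith) (by linarith) (by linarith)
          linarith
      have h1 : ‖(h : ℂ) / 2 * ∫ t in (y - x)..(y + x), cosPoly c t‖ ≤ |h| / 2 * A := by
        rw [norm_mul, norm_div, Complex.norm_real, Complex.norm_ofNat, Real.norm_eq_abs]
        gcongr
        exact norm_integral_cosPoly_le c (by linarith) (by linarith) (by linarith)
      have hqx := hq.intervalIntegrable hxpi
      have i1 : IntervalIntegrable (fun s => (A / 2) * |q s|) volume 0 x := hqx.abs.const_mul _
      have i2 : IntervalIntegrable (fun s => (Real.pi * K) * (|q s| * Real.exp (L * s)))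
          volume 0 x :=
        (hqx.abs.mul_continuousOn (g := fun s => Real.exp (L * s)) (by fun_prop)).const_mul _
      have h2 : ‖∫ s in (0 : ℝ)..x, (q s : ℂ) *
          ((∫ t in (y - (x - s))..(y + (x - s)), wave φ c s t) / 2)‖ ≤
          A / 2 * Q + K * (Real.exp (L * x) / 2) := by
        refine (norm_integral_le_of_norm_le hx (Eventually.of_forall fun s hs => ?_)
          (i1.add i2)).trans ?_
        · rw [norm_mul, norm_div, Complex.norm_real, Complex.norm_ofNat, Real.norm_eq_abs]
          have := hinner s hs
          calc |q s| * (‖∫ t in (y - (x - s))..(y + (x - s)), wave φ c s t‖ / 2)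
              ≤ |q s| * ((A + 2 * Real.pi * (K * Real.exp (L * s))) / 2) := by gcongr
            _ = _ := by ring
        · rw [integral_add i1 i2, intervalIntegral.integral_const_mul,
            intervalIntegral.integral_const_mul]
          have hm : ∫ s in (0 : ℝ)..x, |q s| ≤ Q :=
            integral_mono_interval le_rfl hx hxpi.2 (Eventually.of_forall fun _ => abs_nonneg _)
              (hq.intervalIntegrable hpi).abs
          have hw' := hw x hxpi
          refine add_le_add (by gcongr) ?_
          calc Real.pi * K * ∫ s in (0 : ℝ)..x, |q s| * Real.exp (L * s)
              = K * (Real.pi * ∫ s in (0 : ℝ)..x, |q s| * Real.exp (L * s)) := by ring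
            _ ≤ _ := by gcongr
      have h3 : 1 ≤ Real.exp (L * x) := Real.one_le_exp (mul_nonneg hL.le hx)
      calc _ ≤ |h| / 2 * A + (A / 2 * Q + K * (Real.exp (L * x) / 2)) :=
            (norm_add_le _ _).trans (add_le_add h1 h2)
        _ = (|h| + Q) / 2 * A * 1 + K / 2 * Real.exp (L * x) := by ring
        _ ≤ (|h| + Q) / 2 * A * Real.exp (L * x) + K / 2 * Real.exp (L * x) := by gcongr
        _ = _ := by ring) ⟨(x, y), hx, hy⟩
  simp only at key
  have hxpi : x ≤ Real.pi := by linarith [abs_nonneg y, hx₀.2]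
  have hA := integral_norm_cosPoly_le c hx₀
  have hexp : Real.exp (L * x) ≤ Real.exp (L * Real.pi) := by gcongr
  calc ‖waveDiff φ c x y‖ ≤ 2 * ((|h| + Q) / 2 * A) * Real.exp (L * x) := key
    _ = (|h| + Q) * A * Real.exp (L * x) := by ring
    _ ≤ (|h| + Q) * (2 * √Real.pi * cosPolyNorm c x₀) * Real.exp (L * Real.pi) := by
        have : 0 ≤ cosPolyNorm c x₀ := Real.sqrt_nonneg _
        gcongr
    _ = _ := by ring

end Wave

end WaveEstimate

/-! ### Integral representations of `φ` and `φ'` -/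

section Transmutation

open MeasureTheory Filter Topology Set intervalIntegral unitInterval

/-- A linear functional bounded by `‖A ·‖` is represented through `A` by a vector: it descends to
the range of `A`, extends by Hahn–Banach, and Riesz' theorem applies. -/
lemma exists_inner_eq_of_norm_le {V E : Type*} [AddCommGroup V] [Module ℂ V]
    [NormedAddCommGroup E] [InnerProductSpace ℂ E] [CompleteSpace E]
    (F : V →ₗ[ℂ] ℂ) (A : V →ₗ[ℂ] E) {C : ℝ} (hC : 0 ≤ C) (hF : ∀ v, ‖F v‖ ≤ C * ‖A v‖) :
    ∃ f : E, ‖f‖ ≤ C ∧ ∀ v, F v = inner ℂ f (A v) := by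
  have hker : LinearMap.ker A ≤ LinearMap.ker F := fun v hv => by
    rw [LinearMap.mem_ker] at hv ⊢
    have := hF v
    rw [hv, norm_zero, mul_zero] at this
    exact norm_le_zero_iff.1 this
  let G : LinearMap.range A →ₗ[ℂ] ℂ :=
    ((LinearMap.ker A).liftQ F hker).comp A.quotKerEquivRange.symm.toLinearMap
  have hG : ∀ v, G ⟨A v, LinearMap.mem_range_self A v⟩ = F v := fun v => by
    have : A.quotKerEquivRange.symm ⟨A v, LinearMap.mem_range_self A v⟩ =
        (LinearMap.ker A).mkQ v := by
      rw [LinearEquiv.symm_apply_eq]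
      rfl
    simp only [G, LinearMap.comp_apply, LinearEquiv.coe_coe, this]
    simp
  have hGb : ∀ w, ‖G w‖ ≤ C * ‖w‖ := by
    rintro ⟨_, v, rfl⟩
    rw [hG]
    exact hF v
  obtain ⟨g, hg, hgn⟩ := exists_extension_norm_eq (LinearMap.range A) (G.mkContinuous C hGb)
  refine ⟨(InnerProductSpace.toDual ℂ E).symm g, ?_, fun v => ?_⟩
  · rw [LinearIsometryEquiv.norm_map, hgn]
    exact LinearMap.mkContinuous_norm_le _ hC _
  · rw [InnerProductSpace.toDual_symm_apply, ← hG v]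
    exact (hg ⟨A v, LinearMap.mem_range_self A v⟩).symm

lemma norm_toL2I_sq (g : C(I, ℂ)) : ‖toL2I g‖ ^ 2 = ∫ t : I, ‖g t‖ ^ 2 := by
  have h := inner_self_eq_norm_sq_to_K (𝕜 := ℂ) (toL2I g)
  rw [ContinuousMap.inner_toLp] at h
  have e : ∀ t : I, g t * starRingEnd ℂ (g t) = ((‖g t‖ ^ 2 : ℝ) : ℂ) := fun t => by
    rw [Complex.mul_conj']; push_cast; rfl
  simp_rw [e] at h
  rw [integral_complex_ofReal] at h
  exact (Complex.ofReal_injective (h.trans (Complex.ofReal_pow _ 2).symm)).symm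

lemma cosPolyNorm_eq (c : ℂ →₀ ℂ) {x : ℝ} (hx : 0 ≤ x) : cosPolyNorm c x =
    √x * ‖Finsupp.linearCombination ℂ (fun ρ : ℂ => cosVec (ρ * x)) c‖ := by
  have e : Finsupp.linearCombination ℂ (fun ρ : ℂ => cosVec (ρ * x)) c =
      toL2I (∑ ρ ∈ c.support, c ρ • cosMap (ρ * x)) := by
    rw [Finsupp.linearCombination_apply, Finsupp.sum, map_sum]
    simp [cosVec]
  have e2 : ∀ t : I, (∑ ρ ∈ c.support, c ρ • cosMap (ρ * x)) t = cosPoly c (x * (t : ℝ)) := by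
    intro t
    simp [cosPoly, cosMap, mul_assoc]
  rw [cosPolyNorm, ← Real.sqrt_sq (norm_nonneg (Finsupp.linearCombination ℂ
    (fun ρ : ℂ => cosVec (ρ * x)) c)), ← Real.sqrt_mul hx, e, norm_toL2I_sq]
  simp_rw [e2]
  rw [integral_unitInterval (fun t : ℝ => ‖cosPoly c (x * t)‖ ^ 2), ← smul_eq_mul,
    smul_integral_comp_mul_left (fun t => ‖cosPoly c t‖ ^ 2)]
  simp

lemma cosPolyNorm_le (c : ℂ →₀ ℂ) {x : ℝ} (hx : x ∈ Icc 0 Real.pi) : cosPolyNorm c x ≤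
    √Real.pi * ‖Finsupp.linearCombination ℂ (fun ρ : ℂ => cosVec (ρ * x)) c‖ := by
  rw [cosPolyNorm_eq c hx.1]
  exact mul_le_mul_of_nonneg_right (Real.sqrt_le_sqrt hx.2) (norm_nonneg _)

/-- From a bound on cosine polynomials to an integral representation. For `x = 0` the hypothesis
forces `F = 0`. -/
lemma exists_inner_cosVec_eq {x : ℝ} (hx : x ∈ Icc 0 Real.pi) {C : ℝ} (hC : 0 ≤ C) (F : ℂ → ℂ)
    (hF : ∀ c : ℂ →₀ ℂ, ‖∑ ρ ∈ c.support, c ρ * F ρ‖ ≤ C * cosPolyNorm c x) :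
    ∃ f : L2I, ‖f‖ ≤ C * √Real.pi ∧ ∀ ρ : ℂ, F ρ = inner ℂ f (cosVec (ρ * x)) := by
  obtain ⟨f, hf, h⟩ := exists_inner_eq_of_norm_le (Finsupp.linearCombination ℂ F)
    (Finsupp.linearCombination ℂ (fun ρ : ℂ => cosVec (ρ * x))) (C := C * √Real.pi)
    (by positivity) (fun c => by
      rw [Finsupp.linearCombination_apply, Finsupp.sum, mul_assoc]
      exact (hF c).trans (mul_le_mul_of_nonneg_left (cosPolyNorm_le c hx) hC))
  refine ⟨f, hf, fun ρ => ?_⟩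
  have := h (Finsupp.single ρ 1)
  simpa using this

section Representation

variable {q : ℝ → ℝ} {h : ℝ} {φ dφ : ℂ → ℝ → ℂ}

/-- The transmutation representation of `φ(ρ, x)`, from the bound of `waveDiff` at the point
`(x, 0)`. The kernel is rescaled to the interval `[0, 1]`. -/
lemma IsPhi.exists_inner_cosVec (hq : IsSquareIntegrable q) (hφ : IsPhi q h φ dφ) :
    ∃ C : ℝ, ∀ x ∈ Icc 0 Real.pi, ∃ f : L2I, ‖f‖ ≤ C ∧
      ∀ ρ : ℂ, φ ρ x = Complex.cos (ρ * x) + inner ℂ f (cosVec (ρ * x)) := by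
  obtain ⟨C, hC, hb⟩ := hφ.exists_norm_waveDiff_le hq
  refine ⟨C * √Real.pi, fun x hx => ?_⟩
  obtain ⟨f, hf, h⟩ := exists_inner_cosVec_eq hx hC (fun ρ => φ ρ x - Complex.cos (ρ * x))
    (fun c => by
      have := hb c x hx x 0 hx.1 (by simp)
      rw [waveDiff_eq_sum] at this
      simpa using this)
  exact ⟨f, hf, fun ρ => by rw [← h]; ring⟩

/-- The remainder of `φ'(ρ, x)` after its leading terms, summed against coefficients, in terms of
`waveDiff` on the characteristic through `(x, 0)` and of the data. -/
lemma IsPhi.sum_deriv_eq (hq : IsSquareIntegrable q) (hφ : IsPhi q h φ dφ) (c : ℂ →₀ ℂ) {x : ℝ}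
    (hx : x ∈ Icc 0 Real.pi) :
    ∑ ρ ∈ c.support, c ρ * (dφ ρ x - (-ρ * Complex.sin (ρ * x) +
        ((h + 1 / 2 * ∫ s in (0 : ℝ)..x, q s : ℝ) : ℂ) * Complex.cos (ρ * x))) =
      ∫ s in (0 : ℝ)..x, q s * (waveDiff φ c s (x - s) + cosPoly c (x - 2 * s) / 2) := by
  have hqx := hq.intervalIntegrable_ofReal hx
  have hcφ : ∀ ρ, ContinuousOn (φ ρ) (uIcc 0 x) := fun ρ => by
    rw [uIcc_of_le hx.1]
    exact (hφ.continuousOn ρ).mono (Icc_subset_Icc_right hx.2)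
  have e : ∀ s : ℝ, (q s : ℂ) * (waveDiff φ c s (x - s) + cosPoly c (x - 2 * s) / 2) =
      ∑ ρ ∈ c.support, c ρ * (Complex.cos (ρ * (x - s)) * (q s * φ ρ s) -
        q s * (Complex.cos (ρ * x) / 2)) := by
    intro s
    rw [waveDiff_eq_sum, cosPoly, Finset.sum_div, ← Finset.sum_add_distrib, Finset.mul_sum]
    refine Finset.sum_congr rfl fun ρ _ => ?_
    have k1 : Complex.cos (ρ * x) = Complex.cos (ρ * s) * Complex.cos (ρ * (x - s)) -
        Complex.sin (ρ * s) * Complex.sin (ρ * (x - s)) := by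
      rw [← Complex.cos_add]; ring_nf
    have k2 : Complex.cos (ρ * (x - 2 * s)) = Complex.cos (ρ * s) * Complex.cos (ρ * (x - s)) +
        Complex.sin (ρ * s) * Complex.sin (ρ * (x - s)) := by
      rw [← Complex.cos_sub, ← Complex.cos_neg]; ring_nf
    push_cast
    rw [k1, k2]
    ring
  have i1 : ∀ ρ, IntervalIntegrable (fun s : ℝ => Complex.cos (ρ * (x - s)) * (q s * φ ρ s))
      volume 0 x := fun ρ =>
    (hqx.mul_continuousOn (hcφ ρ)).continuousOn_mul (by fun_prop)
  have i2 : ∀ ρ, IntervalIntegrable (fun s : ℝ => (q s : ℂ) * (Complex.cos (ρ * x) / 2))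
      volume 0 x := fun ρ => hqx.mul_const _
  simp_rw [e]
  rw [intervalIntegral.integral_finsetSum fun ρ _ => ((i1 ρ).sub (i2 ρ)).const_mul _]
  refine Finset.sum_congr rfl fun ρ _ => ?_
  rw [intervalIntegral.integral_const_mul, integral_sub (i1 ρ) (i2 ρ),
    intervalIntegral.integral_mul_const, intervalIntegral.integral_ofReal]
  have k1 := (hφ ρ).1.deriv_eq_cos hq hx
  rw [(hφ ρ).2.1, (hφ ρ).2.2] at k1
  rw [k1]
  push_cast
  ring

/-- The transmutation representation of `φ'(ρ, x)`. -/
lemma IsPhi.exists_inner_cosVec_deriv (hq : IsSquareIntegrable q) (hφ : IsPhi q h φ dφ) {x : ℝ}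
    (hx : x ∈ Icc 0 Real.pi) : ∃ f : L2I, ∀ ρ : ℂ, dφ ρ x = -ρ * Complex.sin (ρ * x) +
      ((h + 1 / 2 * ∫ s in (0 : ℝ)..x, q s : ℝ) : ℂ) * Complex.cos (ρ * x) +
        inner ℂ f (cosVec (ρ * x)) := by
  obtain ⟨C, hC, hb⟩ := hφ.exists_norm_waveDiff_le hq
  have hqx := hq.intervalIntegrable hx
  have hN : 0 ≤ potentialNorm q := Real.sqrt_nonneg _
  have hI : 0 ≤ ∫ s in (0 : ℝ)..x, |q s| := integral_nonneg hx.1 fun _ _ => abs_nonneg _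
  obtain ⟨f, -, hf⟩ := exists_inner_cosVec_eq hx
    (C := C * (∫ s in (0 : ℝ)..x, |q s|) + potentialNorm q / 2) (by positivity)
    (fun ρ => dφ ρ x - (-ρ * Complex.sin (ρ * x) +
        ((h + 1 / 2 * ∫ s in (0 : ℝ)..x, q s : ℝ) : ℂ) * Complex.cos (ρ * x))) (fun c => by
      rw [hφ.sum_deriv_eq hq c hx]
      have hcU := continuous_cosPoly c
      have i1 : IntervalIntegrable (fun s => (C * cosPolyNorm c x) * |q s|) volume 0 x :=
        hqx.abs.const_mul _
      have i2 : IntervalIntegrable (fun s => (1 / 2 : ℝ) * (|q s| * ‖cosPoly c (x - 2 * s)‖))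
          volume 0 x := (hqx.abs.mul_continuousOn (by fun_prop)).const_mul _
      have hcs := integral_abs_mul_le hx.1 (hq.memLp_Ioc hx)
        (memLp_Ioc_of_continuous (g := fun s => ‖cosPoly c (x - 2 * s)‖) (by fun_prop) x)
      have hsq : ∫ s in (0 : ℝ)..x, ‖cosPoly c (x - 2 * s)‖ ^ 2 =
          ∫ s in (0 : ℝ)..x, ‖cosPoly c s‖ ^ 2 := by
        rw [integral_comp_sub_mul (fun s => ‖cosPoly c s‖ ^ 2) two_ne_zero,
          show x - 2 * x = -x by ring, mul_zero, sub_zero,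
          integral_neg_self_of_even (by fun_prop) (fun t => by rw [cosPoly_neg]), smul_eq_mul]
        ring
      rw [hsq] at hcs
      simp only [abs_norm] at hcs
      refine (norm_integral_le_of_norm_le hx.1 (Eventually.of_forall fun s hs => ?_)
          (i1.add i2)).trans ?_
      · have h1 := hb c x hx s (x - s) hs.1.le (abs_of_nonneg (by linarith [hs.2])).le
        rw [norm_mul, Complex.norm_real, Real.norm_eq_abs]
        have h2 : ‖cosPoly c (x - 2 * s) / 2‖ = ‖cosPoly c (x - 2 * s)‖ / 2 := by simp
        calc |q s| * ‖waveDiff φ c s (x - s) + cosPoly c (x - 2 * s) / 2‖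
            ≤ |q s| * (C * cosPolyNorm c x + ‖cosPoly c (x - 2 * s)‖ / 2) := by
              gcongr
              exact (norm_add_le _ _).trans (add_le_add h1 h2.le)
          _ = _ := by ring
      · rw [integral_add i1 i2, intervalIntegral.integral_const_mul,
            intervalIntegral.integral_const_mul]
        have h1 : ∫ s in (0 : ℝ)..x, |q s| * ‖cosPoly c (x - 2 * s)‖ ≤
            potentialNorm q * cosPolyNorm c x :=
          hcs.trans (mul_le_mul_of_nonneg_right (hq.sqrt_integral_sq_le hx) (Real.sqrt_nonneg _))
        calc _ ≤ C * cosPolyNorm c x * (∫ s in (0 : ℝ)..x, |q s|) +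
              1 / 2 * (potentialNorm q * cosPolyNorm c x) := by gcongr
          _ = _ := by ring)
  exact ⟨f, fun ρ => by rw [← hf]; ring⟩

/-- The potential and `h` are real, so `φ` and `φ'` commute with complex conjugation. -/
lemma IsPhi.conj (hq : IsSquareIntegrable q) (hφ : IsPhi q h φ dφ) (ρ : ℂ) {x : ℝ}
    (hx : x ∈ Icc 0 Real.pi) : φ (starRingEnd ℂ ρ) x = starRingEnd ℂ (φ ρ x) ∧
      dφ (starRingEnd ℂ ρ) x = starRingEnd ℂ (dφ ρ x) := by
  have h1 := (hφ (starRingEnd ℂ ρ)).1.sub_mul hq (hφ ρ).1.conj 1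
  have h2 := h1.eq_zero hq (by simp [(hφ ρ).2.1, (hφ (starRingEnd ℂ ρ)).2.1])
    (by simp [(hφ ρ).2.2, (hφ (starRingEnd ℂ ρ)).2.2]) hx
  simp only [one_mul, sub_eq_zero] at h2
  exact h2

lemma sphericalBesselJ_conj (k : ℕ) (z : ℂ) :
    sphericalBesselJ k (starRingEnd ℂ z) = starRingEnd ℂ (sphericalBesselJ k z) := by
  rw [sphericalBesselJ, sphericalBesselJ, Complex.conj_tsum]
  refine tsum_congr fun m => ?_
  have h2 : starRingEnd ℂ 2 = 2 := map_ofNat _ 2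
  simp [h2]

/-- If `ρ ↦ ⟪f, cos (ρ x ·)⟫` is real on the real axis, its Neumann series has real coefficients. -/
lemma tendstoUniformlyOn_neumann_re {f : L2I} {x : ℝ}
    (hf : ∀ ρ : ℂ, inner ℂ f (cosVec (starRingEnd ℂ ρ * x)) =
      starRingEnd ℂ (inner ℂ f (cosVec (ρ * x)))) {K : Set ℂ} (hK : Bornology.IsBounded K) :
    TendstoUniformlyOn (fun (N : ℕ) (ρ : ℂ) => ∑ n ∈ Finset.range N,
      (-1) ^ n * ((neumannCoeff f n).re : ℂ) * sphericalBesselJ (2 * n) (ρ * x))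
      (fun ρ => inner ℂ f (cosVec (ρ * x))) atTop K := by
  obtain ⟨R, hR⟩ := hK.exists_norm_le
  have h := tendstoUniformlyOn_neumann f
    (Metric.isBounded_closedBall (x := (0 : ℂ)) (r := R * |x|))
  rw [Metric.tendstoUniformlyOn_iff] at h ⊢
  intro ε hε
  filter_upwards [h ε hε] with N hN ρ hρ
  have hb : ‖ρ * x‖ ≤ R * |x| := by
    rw [norm_mul, Complex.norm_real, Real.norm_eq_abs]
    gcongr
    exact hR ρ hρ
  have h1 := hN (ρ * x) (by simpa using hb)
  have h2 := hN (starRingEnd ℂ ρ * x) (by simpa using hb)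
  set S := ∑ n ∈ Finset.range N, (-1) ^ n * neumannCoeff f n * sphericalBesselJ (2 * n) (ρ * x)
  have e2 : ∑ n ∈ Finset.range N, (-1) ^ n * neumannCoeff f n *
      sphericalBesselJ (2 * n) (starRingEnd ℂ ρ * x) = starRingEnd ℂ (∑ n ∈ Finset.range N,
        (-1) ^ n * starRingEnd ℂ (neumannCoeff f n) * sphericalBesselJ (2 * n) (ρ * x)) := by
    rw [map_sum]
    refine Finset.sum_congr rfl fun n _ => ?_
    rw [show starRingEnd ℂ ρ * x = starRingEnd ℂ (ρ * x) by simp, sphericalBesselJ_conj]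
    simp
  rw [hf, e2, dist_eq_norm, ← map_sub, RCLike.norm_conj] at h2
  set T := ∑ n ∈ Finset.range N,
        (-1) ^ n * starRingEnd ℂ (neumannCoeff f n) * sphericalBesselJ (2 * n) (ρ * x)
  have e3 : ∑ n ∈ Finset.range N, (-1) ^ n * ((neumannCoeff f n).re : ℂ) *
      sphericalBesselJ (2 * n) (ρ * x) = (S + T) / 2 := by
    rw [← Finset.sum_add_distrib, Finset.sum_div]
    refine Finset.sum_congr rfl fun n _ => ?_
    rw [Complex.re_eq_add_conj]
    ring
  rw [dist_eq_norm] at h1 ⊢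
  set G : ℂ := inner ℂ f (cosVec (ρ * x))
  -- The real parts of the coefficients are the means of the coefficients and their conjugates.
  rw [e3, show G - (S + T) / 2 = ((G - S) + (G - T)) / 2 by ring, norm_div, Complex.norm_ofNat,
    div_lt_iff₀ two_pos]
  linarith [norm_add_le (G - S) (G - T)]

lemma tendstoUniformlyOn_const_add {A F : ℂ → ℂ} {S : ℕ → ℂ → ℂ} {K : Set ℂ}
    (hS : TendstoUniformlyOn S F atTop K) :
    TendstoUniformlyOn (fun N ρ => A ρ + S N ρ) (fun ρ => A ρ + F ρ) atTop K := by
  rw [Metric.tendstoUniformlyOn_iff] at hS ⊢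
  simpa only [dist_add_left] using hS

/-- The Neumann series of Bessel functions exist, with real coefficients. -/
theorem IsPhi.exists_isNSBF (hq : IsSquareIntegrable q) (hφ : IsPhi q h φ dφ) :
    ∃ g γ : ℕ → ℝ → ℝ, IsNSBF q h φ dφ g γ := by
  obtain ⟨_, h1⟩ := hφ.exists_inner_cosVec hq
  have h1' : ∀ x : ℝ, ∃ f : L2I, x ∈ Icc 0 Real.pi →
      ∀ ρ : ℂ, φ ρ x = Complex.cos (ρ * x) + inner ℂ f (cosVec (ρ * x)) := fun x => by
    by_cases hx : x ∈ Icc 0 Real.pi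
    · obtain ⟨f, -, hf⟩ := h1 x hx
      exact ⟨f, fun _ => hf⟩
    · exact ⟨0, fun hx' => absurd hx' hx⟩
  have h2' : ∀ x : ℝ, ∃ f : L2I, x ∈ Icc 0 Real.pi →
      ∀ ρ : ℂ, dφ ρ x = -ρ * Complex.sin (ρ * x) +
      ((h + 1 / 2 * ∫ s in (0 : ℝ)..x, q s : ℝ) : ℂ) * Complex.cos (ρ * x) +
        inner ℂ f (cosVec (ρ * x)) := fun x => by
    by_cases hx : x ∈ Icc 0 Real.pi
    · obtain ⟨f, hf⟩ := hφ.exists_inner_cosVec_deriv hq hx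
      exact ⟨f, fun _ => hf⟩
    · exact ⟨0, fun hx' => absurd hx' hx⟩
  choose f hf using h1'
  choose f' hf' using h2'
  refine ⟨fun n x => (neumannCoeff (f x) n).re, fun n x => (neumannCoeff (f' x) n).re,
    fun x hx K hK => ⟨?_, ?_⟩⟩
  · refine (tendstoUniformlyOn_const_add (tendstoUniformlyOn_neumann_re (fun ρ => ?_)
      hK.isBounded)).congr_right fun ρ _ => (hf x hx ρ).symm
    have k1 := hf x hx ρ
    have k2 := hf x hx (starRingEnd ℂ ρ)
    rw [(hφ.conj hq ρ hx).1, k1, map_add, ← Complex.cos_conj, map_mul, Complex.conj_ofReal] at k2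
    exact (add_left_cancel k2).symm
  · refine (tendstoUniformlyOn_const_add (tendstoUniformlyOn_neumann_re (fun ρ => ?_)
      hK.isBounded)).congr_right fun ρ _ => (hf' x hx ρ).symm
    have k1 := hf' x hx ρ
    have k2 := hf' x hx (starRingEnd ℂ ρ)
    rw [(hφ.conj hq ρ hx).2, k1, map_add, map_add, map_mul, map_mul, map_neg, ← Complex.cos_conj,
      ← Complex.sin_conj, map_mul, Complex.conj_ofReal, Complex.conj_ofReal] at k2
    exact (add_left_cancel k2).symm

end Representation

end Transmutation

/-! ### The characteristic function and completeness -/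

section Spectrum

open MeasureTheory Filter Topology Set intervalIntegral unitInterval

lemma sphericalBesselJ_zero_right (n : ℕ) :
    sphericalBesselJ (2 * n) 0 = if n = 0 then 1 else 0 := by
  rw [sphericalBesselJ_eq_pow_mul]
  split_ifs with h
  · subst h
    rw [reducedBesselJ, tsum_eq_single 0 fun m hm => by simp [hm]]
    simp
  · rw [zero_pow (by omega), zero_mul]

/-- At the origin only the term with `j₀` survives in a Neumann series. -/
lemma inner_cosVec_zero (f : L2I) : inner ℂ f (cosVec 0) = neumannCoeff f 0 := by
  refine (hasSum_neumann f 0).unique ?_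
  convert hasSum_single (f := fun n : ℕ => (-1) ^ n * neumannCoeff f n *
    sphericalBesselJ (2 * n) 0) 0 (fun n hn => ?_) using 1
  · have h0 := sphericalBesselJ_zero_right 0
    rw [if_pos rfl] at h0
    rw [h0, pow_zero, one_mul, mul_one]
  · simp [sphericalBesselJ_zero_right, hn]

/-- On the imaginary axis `‖cos (z ·)‖` is smaller than `exp |Im z|` by a factor tending to zero,
because the mass of `cosh (y t)` concentrates at `t = 1`. -/
lemma norm_cosVec_mul_I_le {y : ℝ} (hy : 0 < y) :
    ‖cosVec (y * Complex.I)‖ ≤ Real.exp y / √(2 * y) := by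
  refine le_of_sq_le_sq ?_ (by positivity)
  rw [cosVec, norm_toL2I_sq, div_pow, Real.sq_sqrt (by positivity)]
  have h1 : ∀ t : I, ‖cosMap (y * Complex.I) t‖ ^ 2 ≤ Real.exp ((2 * y) * (t : ℝ)) := fun t => by
    have := norm_cos_le (y * Complex.I * (t : ℝ))
    have e : |((y : ℂ) * Complex.I * ((t : ℝ) : ℂ)).im| = y * t := by
      rw [Complex.im_mul_ofReal]
      simp [abs_of_nonneg (mul_nonneg hy.le t.2.1)]
    rw [e] at this
    calc ‖cosMap (y * Complex.I) t‖ ^ 2 ≤ Real.exp (y * t) ^ 2 := by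
          gcongr
          exact this
      _ = _ := by rw [← Real.exp_nat_mul]; push_cast; ring_nf
  calc ∫ t : I, ‖cosMap (y * Complex.I) t‖ ^ 2 ≤ ∫ t : I, Real.exp ((2 * y) * (t : ℝ)) := by
        refine integral_mono ?_ ?_ h1
        · exact (Continuous.integrable_of_hasCompactSupport (by fun_prop)
            (HasCompactSupport.of_compactSpace _))
        · exact (Continuous.integrable_of_hasCompactSupport (by fun_prop)
            (HasCompactSupport.of_compactSpace _))
    _ ≤ _ := by
        rw [integral_unitInterval (fun t : ℝ => Real.exp ((2 * y) * t)),
          integral_comp_mul_left (fun s => Real.exp s) (by positivity), integral_exp, smul_eq_mul,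
          inv_mul_eq_div, ← Real.exp_nat_mul]
        gcongr
        simp

/-- The quotient of two entire functions is entire if it is bounded near every zero of the
denominator. -/
lemma exists_differentiable_quotient {G F : ℂ → ℂ} (hG : Differentiable ℂ G)
    (hF : Differentiable ℂ F) (hloc : ∀ z₀, F z₀ = 0 →
      ∃ C, ∀ᶠ z in 𝓝[≠] z₀, F z ≠ 0 ∧ ‖G z / F z‖ ≤ C) :
    ∃ Q : ℂ → ℂ, Differentiable ℂ Q ∧ ∀ z, F z ≠ 0 → Q z = G z / F z := by
  classical
  let Q : ℂ → ℂ := fun z => if F z = 0 then limUnder (𝓝[≠] z) (fun w => G w / F w) else G z / F z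
  refine ⟨Q, fun z₀ => ?_, fun z hz => if_neg hz⟩
  by_cases h0 : F z₀ = 0
  · obtain ⟨C, hC⟩ := hloc z₀ h0
    rw [eventually_nhdsWithin_iff] at hC
    set s := {z | z ≠ z₀ → F z ≠ 0 ∧ ‖G z / F z‖ ≤ C} with hs
    have hsn : s ∈ 𝓝 z₀ := hC
    have hd := Complex.differentiableOn_update_limUnder_of_bddAbove (f := fun w => G w / F w)
      hsn (fun z hz => ((hG z).div (hF z) (hz.1 hz.2).1).differentiableWithinAt)
      ⟨C, by rintro _ ⟨z, hz, rfl⟩; exact (hz.1 hz.2).2⟩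
    refine (hd.differentiableAt hsn).congr_of_eventuallyEq ?_
    filter_upwards [hsn] with z hz
    rcases eq_or_ne z z₀ with rfl | hne
    · simp [Q, h0]
    · simp [Q, Function.update_of_ne hne, (hz hne).1]
  · have : Q =ᶠ[𝓝 z₀] fun w => G w / F w := by
      filter_upwards [(hF z₀).continuousAt.eventually_ne h0] with z hz
      exact if_neg hz
    exact ((hG z₀).div (hF z₀) h0).congr_of_eventuallyEq this

lemma norm_sin_sq (z : ℂ) : ‖Complex.sin z‖ ^ 2 = Real.sin z.re ^ 2 + Real.sinh z.im ^ 2 := by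
  rw [Complex.sin_eq, ← Complex.ofReal_sin, ← Complex.ofReal_cos, ← Complex.ofReal_sinh,
    ← Complex.ofReal_cosh, ← Complex.ofReal_mul, ← Complex.ofReal_mul, ← Complex.normSq_eq_norm_sq,
    Complex.normSq_add_mul_I]
  have h1 := Real.sin_sq_add_cos_sq z.re
  have h2 := Real.cosh_sq z.im
  rw [mul_pow, mul_pow, h2]
  linear_combination (Real.sinh z.im ^ 2) * h1

lemma norm_sin_ge_of_sin_sq_eq_one {z : ℂ} (h : Real.sin z.re ^ 2 = 1) :
    Real.exp |z.im| / 4 ≤ ‖Complex.sin z‖ := by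
  refine le_of_sq_le_sq ?_ (norm_nonneg _)
  rw [norm_sin_sq, h, ← sq_abs (Real.sinh _), Real.abs_sinh, add_comm, ← Real.cosh_sq]
  have : Real.exp |z.im| / 4 ≤ Real.cosh |z.im| := by
    rw [Real.cosh_eq]
    linarith [Real.exp_pos |z.im|, Real.exp_pos (-|z.im|)]
  gcongr

lemma norm_sin_ge_of_one_le {z : ℂ} (h : 1 ≤ |z.im|) :
    Real.exp |z.im| / 4 ≤ ‖Complex.sin z‖ := by
  refine le_of_sq_le_sq ?_ (norm_nonneg _)
  rw [norm_sin_sq, ← sq_abs (Real.sinh _), Real.abs_sinh]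
  have : Real.exp |z.im| / 4 ≤ Real.sinh |z.im| := by
    rw [Real.sinh_eq]
    have h1 := Real.add_one_le_exp |z.im|
    have h2 : Real.exp (-|z.im|) ≤ 1 := Real.exp_le_one_iff.2 (by linarith)
    linarith
  nlinarith [sq_nonneg (Real.sin z.re), Real.exp_pos |z.im|]

/-- The boundary of the square with half-side `N + 1/2` keeps away from the zeros of `sin (π z)`:
on the vertical sides `|sin (π Re z)| = 1`, and on the horizontal sides `|Im z|` is large. -/
lemma norm_sin_ge_on_square {N : ℕ} (hN : 1 ≤ N) {z : ℂ}
    (hz : z ∈ frontier (Ioo (-(N + 1 / 2 : ℝ)) (N + 1 / 2) ×ℂ Ioo (-(N + 1 / 2 : ℝ)) (N + 1 / 2))) :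
    (N : ℝ) ≤ ‖z‖ ∧ Real.exp (|z.im| * Real.pi) / 4 ≤ ‖Complex.sin (z * Real.pi)‖ := by
  have hN' : (1 : ℝ) ≤ N := by exact_mod_cast hN
  have hlt : -(N + 1 / 2 : ℝ) < N + 1 / 2 := by linarith
  have habs : ∀ {x : ℝ}, x = -(N + 1 / 2 : ℝ) ∨ x = N + 1 / 2 → |x| = N + 1 / 2 := by
    rintro x (rfl | rfl)
    · rw [abs_neg, abs_of_nonneg (by linarith)]
    · exact abs_of_nonneg (by linarith)
  have him : |(z * Real.pi).im| = |z.im| * Real.pi := by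
    rw [Complex.im_mul_ofReal, abs_mul, abs_of_pos Real.pi_pos]
  rw [Complex.frontier_reProdIm, frontier_Ioo hlt] at hz
  rw [← him]
  rcases hz with hz | hz
  · have h := habs hz.2
    refine ⟨by linarith [Complex.abs_im_le_norm z], norm_sin_ge_of_one_le ?_⟩
    rw [him, h]
    nlinarith [Real.pi_gt_three]
  · have h := habs hz.1
    refine ⟨by linarith [Complex.abs_re_le_norm z], norm_sin_ge_of_sin_sq_eq_one ?_⟩
    have h1 : Real.sin ((N + 1 / 2) * Real.pi) ^ 2 = 1 := by
      rw [add_mul, show (1 / 2 : ℝ) * Real.pi = Real.pi / 2 by ring, Real.sin_add_pi_div_two,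
        Real.cos_nat_mul_pi, ← pow_mul, mul_comm, pow_mul]
      simp
    rw [Complex.re_mul_ofReal]
    rcases hz.1 with h' | h' <;> rw [h']
    · rw [neg_mul, Real.sin_neg, neg_sq, h1]
    · exact h1

section Characteristic

variable {q : ℝ → ℝ} {h H : ℝ} {φ dφ : ℂ → ℝ → ℂ}

/-- The characteristic function `Φ(ρ) = φ'(ρ, π) + H φ(ρ, π)`. -/
def charFun (H : ℝ) (φ dφ : ℂ → ℝ → ℂ) (z : ℂ) : ℂ := dφ z Real.pi + H * φ z Real.pi

lemma pi_mem : Real.pi ∈ Icc 0 Real.pi := right_mem_Icc.2 Real.pi_pos.le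

/-- The integral representation of the characteristic function. -/
lemma IsPhi.exists_charFun_eq (hq : IsSquareIntegrable q) (hφ : IsPhi q h φ dφ) (H : ℝ) :
    ∃ f : L2I, ∀ z : ℂ, charFun H φ dφ z = -z * Complex.sin (z * Real.pi) +
      (omega q h H : ℂ) * Complex.cos (z * Real.pi) + inner ℂ f (cosVec (z * Real.pi)) := by
  obtain ⟨_, h1⟩ := hφ.exists_inner_cosVec hq
  obtain ⟨f, -, hf⟩ := h1 Real.pi pi_mem
  obtain ⟨f', hf'⟩ := hφ.exists_inner_cosVec_deriv hq pi_mem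
  refine ⟨f' + (H : ℂ) • f, fun z => ?_⟩
  rw [charFun, hf, hf', inner_add_left, inner_smul_left, Complex.conj_ofReal, omega]
  push_cast
  ring

/-- The zeros of the characteristic function are the square roots of the eigenvalues: an
eigenfunction `y` is the multiple `y(0) φ` of `φ`. -/
lemma IsPhi.charFun_eq_zero_iff (hq : IsSquareIntegrable q) (hφ : IsPhi q h φ dφ) (z : ℂ) :
    charFun H φ dφ z = 0 ↔ z ^ 2 ∈ spectrum q h H := by
  constructor
  · intro h0
    exact ⟨φ z, dφ z, (hφ z).1, by rw [(hφ z).2.1, (hφ z).2.2]; ring, h0, 0,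
      left_mem_Icc.2 Real.pi_pos.le, by rw [(hφ z).2.1]; exact one_ne_zero⟩
  · rintro ⟨y, dy, hy, h0, hpi, x, hx, hne⟩
    have hs := hy.sub_mul hq (hφ z).1 (y 0)
    have hs0 : ∀ {x}, x ∈ Icc 0 Real.pi → y x - y 0 * φ z x = 0 ∧ dy x - y 0 * dφ z x = 0 :=
      fun hx => hs.eq_zero hq (by rw [(hφ z).2.1]; ring)
        (by rw [(hφ z).2.2]; linear_combination h0) hx
    have hy0 : y 0 ≠ 0 := fun h00 => hne (by simpa [h00] using (hs0 hx).1)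
    have e := hs0 pi_mem
    refine (mul_eq_zero.1 ?_).resolve_left hy0
    rw [charFun]
    linear_combination hpi - e.2 - H * e.1

lemma IsPhi.exists_norm_le (hq : IsSquareIntegrable q) (hφ : IsPhi q h φ dφ) (R : ℝ) :
    ∃ B : ℝ, ∀ z : ℂ, ‖z‖ ≤ R → ∀ x ∈ Icc 0 Real.pi, ‖φ z x‖ ≤ B := by
  obtain ⟨C, hC⟩ := hφ.exists_inner_cosVec hq
  refine ⟨(1 + |C|) * Real.exp (R * Real.pi), fun z hz x hx => ?_⟩
  obtain ⟨f, hf, he⟩ := hC x hx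
  have him : |(z * x).im| ≤ R * Real.pi := by
    refine (Complex.abs_im_le_norm _).trans ?_
    rw [norm_mul, Complex.norm_real, Real.norm_eq_abs, abs_of_nonneg hx.1]
    have := (norm_nonneg z).trans hz
    exact mul_le_mul hz hx.2 hx.1 this
  have hexp := Real.exp_le_exp.2 him
  rw [he]
  calc _ ≤ Real.exp |(z * x).im| + ‖f‖ * Real.exp |(z * x).im| :=
        (norm_add_le _ _).trans (add_le_add (norm_cos_le _) ((norm_inner_le_norm _ _).trans
          (mul_le_mul_of_nonneg_left (norm_cosVec_le _) (norm_nonneg _))))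
    _ ≤ Real.exp (R * Real.pi) + |C| * Real.exp (R * Real.pi) := by
        gcongr
        exact hf.trans (le_abs_self C)
    _ = _ := by ring

lemma IsPhi.continuous_left (hq : IsSquareIntegrable q) (hφ : IsPhi q h φ dφ) {x : ℝ}
    (hx : x ∈ Icc 0 Real.pi) : Continuous fun z => φ z x := by
  obtain ⟨C, hC⟩ := hφ.exists_inner_cosVec hq
  obtain ⟨f, -, he⟩ := hC x hx
  rw [funext he]
  exact Continuous.add (by fun_prop)
    ((differentiable_inner_cosVec f).continuous.comp (by fun_prop : Continuous fun z : ℂ => z * x))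

/-- The Wronskian identity shows that a real zero of the characteristic function is simple as a
zero in `z ^ 2`: here `J z = ∫ φ(z, ·) φ(z₀, ·)`, which at `z₀` is the integral of the square of a
real function, and `κ = φ(z₀, π)`. -/
lemma IsPhi.exists_charFun_mul_eq (hq : IsSquareIntegrable q) (hφ : IsPhi q h φ dφ) {z₀ : ℂ}
    (hreal : starRingEnd ℂ z₀ = z₀) (h0 : charFun H φ dφ z₀ = 0) :
    ∃ J : ℂ → ℂ, ∃ κ : ℂ, ContinuousAt J z₀ ∧ J z₀ ≠ 0 ∧
      ∀ z, charFun H φ dφ z * κ = (z₀ ^ 2 - z ^ 2) * J z := by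
  refine ⟨fun z => ∫ t in (0 : ℝ)..Real.pi, φ z t * φ z₀ t, φ z₀ Real.pi, ?_, ?_, fun z => ?_⟩
  · obtain ⟨B, hB⟩ := hφ.exists_norm_le hq (‖z₀‖ + 1)
    have hmem : ∀ {t : ℝ}, t ∈ uIoc 0 Real.pi → t ∈ Icc 0 Real.pi := fun ht => by
      rw [uIoc_of_le Real.pi_pos.le] at ht
      exact Ioc_subset_Icc_self ht
    have hnear : ∀ᶠ z in 𝓝 z₀, ‖z‖ ≤ ‖z₀‖ + 1 :=
      (continuous_norm.tendsto z₀).eventually (eventually_le_nhds (by linarith))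
    refine continuousAt_of_dominated_interval (bound := fun _ => B * B)
      (Eventually.of_forall fun z => ?_) ?_ intervalIntegrable_const
      (Eventually.of_forall fun t ht => ?_)
    · have hc : ContinuousOn (fun t => φ z t * φ z₀ t) (Icc 0 Real.pi) :=
        (hφ.continuousOn z).mul (hφ.continuousOn z₀)
      exact (hc.mono fun t ht => hmem ht).aestronglyMeasurable measurableSet_uIoc
    · filter_upwards [hnear] with z hz
      refine Eventually.of_forall fun t ht => ?_
      rw [norm_mul]
      have h1 := hB z hz t (hmem ht)
      exact mul_le_mul h1 (hB z₀ (by linarith) t (hmem ht)) (norm_nonneg _)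
        ((norm_nonneg _).trans h1)
    · exact ((hφ.continuous_left hq (hmem ht)).mul continuous_const).continuousAt
  · have hre : ∀ t ∈ Icc 0 Real.pi, φ z₀ t = ((φ z₀ t).re : ℂ) := fun t ht => by
      have := (hφ.conj hq z₀ ht).1
      rw [hreal] at this
      exact (Complex.conj_eq_iff_re.1 this.symm).symm
    have e : ∫ t in (0 : ℝ)..Real.pi, φ z₀ t * φ z₀ t =
        ((∫ t in (0 : ℝ)..Real.pi, (φ z₀ t).re * (φ z₀ t).re : ℝ) : ℂ) := by
      rw [← intervalIntegral.integral_ofReal]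
      refine integral_congr fun t ht => ?_
      rw [uIcc_of_le Real.pi_pos.le] at ht
      rw [Complex.ofReal_mul, ← hre t ht]
    have hc : ContinuousOn (fun t => (φ z₀ t).re) (Icc 0 Real.pi) :=
      Complex.continuous_re.comp_continuousOn (hφ.continuousOn z₀)
    simp only [e]
    rw [Complex.ofReal_ne_zero]
    exact (integral_pos Real.pi_pos (hc.mul hc) (fun t _ => mul_self_nonneg _)
      ⟨0, left_mem_Icc.2 Real.pi_pos.le, by
        change 0 < (φ z₀ 0).re * (φ z₀ 0).re
        rw [(hφ z₀).2.1]
        simp⟩).ne'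
  · have hw := (hφ z).1.wronskian hq (hφ z₀).1
    rw [(hφ z).2.1, (hφ z).2.2, (hφ z₀).2.1, (hφ z₀).2.2] at hw
    rw [charFun] at h0 ⊢
    linear_combination -hw + φ z Real.pi * h0

/-- A zero of an even entire function has multiplicity at least one in `z ^ 2`; at the origin this
needs the vanishing of the derivative. -/
lemma isBigO_sq_sub_sq {G : ℂ → ℂ} (hG : Differentiable ℂ G) (heven : ∀ z, G (-z) = G z) {z₀ : ℂ}
    (h0 : G z₀ = 0) : G =O[𝓝 z₀] fun z => z₀ ^ 2 - z ^ 2 := by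
  have hO : ∀ {F : ℂ → ℂ}, DifferentiableAt ℂ F z₀ → F z₀ = 0 → F =O[𝓝 z₀] fun z => z - z₀ :=
    fun hF h => by simpa [h] using hF.hasDerivAt.isBigO_sub
  rcases eq_or_ne z₀ 0 with rfl | hne
  · have hderiv : deriv G 0 = 0 := by
      have h1 : deriv (fun z => G (-z)) 0 = -deriv G 0 := by
        rw [deriv_comp_neg, neg_zero]
      rw [funext heven] at h1
      exact self_eq_neg.1 h1
    have hD : DifferentiableAt ℂ (dslope G 0) 0 :=
      ((Complex.differentiableOn_dslope (s := univ) univ_mem).2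
        hG.differentiableOn).differentiableAt univ_mem
    have e : G = fun z => (z - 0) * dslope G 0 z := by
      funext z
      have := sub_smul_dslope G 0 z
      rw [h0, sub_zero (G z), smul_eq_mul] at this
      exact this.symm
    rw [e]
    have := (Asymptotics.isBigO_refl (fun z : ℂ => z - 0) (𝓝 0)).mul
      (hO hD (by rw [dslope_same, hderiv]))
    refine this.trans (Asymptotics.IsBigO.of_bound 1 (Eventually.of_forall fun z => ?_))
    simp [pow_two]
  · refine (hO (hG z₀) h0).trans (Asymptotics.IsBigO.of_bound (‖z₀‖)⁻¹ ?_)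
    have hc : Tendsto (fun z => ‖z₀ + z‖) (𝓝 z₀) (𝓝 ‖z₀ + z₀‖) :=
      Continuous.tendsto (by fun_prop) z₀
    have hpos : 0 < ‖z₀‖ := norm_pos_iff.2 hne
    have hlt : ‖z₀‖ < ‖z₀ + z₀‖ := by
      rw [← two_mul, norm_mul, Complex.norm_ofNat]
      linarith
    filter_upwards [hc.eventually (lt_mem_nhds hlt)] with z hz
    rw [show z₀ ^ 2 - z ^ 2 = (z₀ + z) * (z₀ - z) by ring, norm_mul, norm_sub_rev z z₀,
      ← mul_assoc]
    refine le_mul_of_one_le_left (norm_nonneg _) ?_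
    rw [inv_mul_eq_div, one_le_div hpos]
    exact hz.le

/-- Near a real zero of the characteristic function, an even entire function with the same zero is
bounded by a multiple of it. -/
lemma IsPhi.exists_norm_div_charFun_le (hq : IsSquareIntegrable q) (hφ : IsPhi q h φ dφ) {G : ℂ → ℂ}
    (hG : Differentiable ℂ G) (heven : ∀ z, G (-z) = G z) {z₀ : ℂ}
    (hreal : starRingEnd ℂ z₀ = z₀) (h0 : charFun H φ dφ z₀ = 0) (hG0 : G z₀ = 0) :
    ∃ C, ∀ᶠ z in 𝓝[≠] z₀, charFun H φ dφ z ≠ 0 ∧ ‖G z / charFun H φ dφ z‖ ≤ C := by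
  obtain ⟨J, κ, hJ, hJ0, hid⟩ := hφ.exists_charFun_mul_eq hq hreal h0
  obtain ⟨C, hC⟩ := (isBigO_sq_sub_sq hG heven hG0).bound
  have hJpos : 0 < ‖J z₀‖ := norm_pos_iff.2 hJ0
  have hJev : ∀ᶠ z in 𝓝 z₀, ‖J z₀‖ / 2 < ‖J z‖ :=
    hJ.norm.eventually (lt_mem_nhds (by linarith))
  have hsq : ∀ᶠ z in 𝓝[≠] z₀, z₀ ^ 2 - z ^ 2 ≠ 0 := by
    rcases eq_or_ne z₀ 0 with rfl | hne
    · filter_upwards [self_mem_nhdsWithin] with z hz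
      have : z ≠ 0 := hz
      simpa using this
    · have h1 : ∀ᶠ z in 𝓝[≠] z₀, z ≠ -z₀ := by
        refine nhdsWithin_le_nhds (IsOpen.mem_nhds isOpen_ne ?_)
        intro h
        exact hne (self_eq_neg.1 h)
      filter_upwards [self_mem_nhdsWithin, h1] with z hz hz'
      have hz : z ≠ z₀ := hz
      rw [sub_ne_zero]
      intro h
      rcases sq_eq_sq_iff_eq_or_eq_neg.1 h.symm with h | h
      · exact hz h
      · exact hz' h
  refine ⟨C * ‖κ‖ * (2 / ‖J z₀‖), ?_⟩
  filter_upwards [hsq, nhdsWithin_le_nhds hC, nhdsWithin_le_nhds hJev] with z h1 h2 h3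
  have hJz : 0 < ‖J z‖ := by linarith
  have hne : charFun H φ dφ z * κ ≠ 0 := by
    rw [hid]
    exact mul_ne_zero h1 (norm_pos_iff.1 hJz)
  have hF := left_ne_zero_of_mul hne
  refine ⟨hF, ?_⟩
  have hκ : 0 < ‖κ‖ := norm_pos_iff.2 (right_ne_zero_of_mul hne)
  have hS : 0 < ‖z₀ ^ 2 - z ^ 2‖ := norm_pos_iff.2 h1
  have hn : ‖charFun H φ dφ z‖ = ‖z₀ ^ 2 - z ^ 2‖ * ‖J z‖ / ‖κ‖ := by
    rw [eq_div_iff hκ.ne', ← norm_mul, hid, norm_mul]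
  have hC0 : 0 ≤ C := by
    by_contra hneg
    have := (norm_nonneg _).trans h2
    nlinarith
  rw [norm_div, hn, div_le_iff₀ (by positivity)]
  calc ‖G z‖ ≤ C * ‖z₀ ^ 2 - z ^ 2‖ := h2
    _ ≤ C * ‖z₀ ^ 2 - z ^ 2‖ * (2 / ‖J z₀‖ * ‖J z‖) := by
        refine le_mul_of_one_le_right (by positivity) ?_
        rw [div_mul_eq_mul_div, one_le_div hJpos]
        linarith
    _ = _ := by field_simp

/-- A function `b cos (ρ π) - ⟪f, cos (ρ π ·)⟫` that vanishes at the zeros of the characteristic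
function `Φ` is zero: its quotient by `Φ` is entire and of size `O(1 / N)` on the square of
half-side `N + 1/2`. -/
lemma IsPhi.eq_zero_of_vanishes (hq : IsSquareIntegrable q) (hφ : IsPhi q h φ dφ)
    (hreal : ∀ z, charFun H φ dφ z = 0 → starRingEnd ℂ z = z) (b : ℂ) (f : L2I)
    (hzero : ∀ z, charFun H φ dφ z = 0 →
      b * Complex.cos (z * Real.pi) - inner ℂ f (cosVec (z * Real.pi)) = 0) (z : ℂ) :
    b * Complex.cos (z * Real.pi) - inner ℂ f (cosVec (z * Real.pi)) = 0 := by
  obtain ⟨p, hp⟩ := hφ.exists_charFun_eq hq H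
  set F := charFun H φ dφ with hFdef
  set G : ℂ → ℂ := fun z => b * Complex.cos (z * Real.pi) - inner ℂ f (cosVec (z * Real.pi))
    with hGdef
  have hin : ∀ f : L2I, Differentiable ℂ fun z : ℂ => inner ℂ f (cosVec (z * Real.pi)) := fun f =>
    (differentiable_inner_cosVec f).comp (by fun_prop)
  have hG : Differentiable ℂ G := by
    have := hin f
    fun_prop
  have hF : Differentiable ℂ F := by
    have := hin p
    rw [funext hp]
    fun_prop
  have heven : ∀ z, G (-z) = G z := fun z => by
    simp only [hGdef, neg_mul, Complex.cos_neg, cosVec_neg]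
  obtain ⟨Q, hQ, hQe⟩ := exists_differentiable_quotient hG hF fun z₀ h0 =>
    hφ.exists_norm_div_charFun_le hq hG heven (hreal z₀ h0) h0 (hzero z₀ h0)
  have hE : ∀ z : ℂ, |(z * Real.pi).im| = |z.im| * Real.pi := fun z => by
    rw [Complex.im_mul_ofReal, abs_mul, abs_of_pos Real.pi_pos]
  have hinle : ∀ (f : L2I) (z : ℂ), ‖inner ℂ f (cosVec (z * Real.pi))‖ ≤
      ‖f‖ * Real.exp (|z.im| * Real.pi) := fun f z =>
    (norm_inner_le_norm _ _).trans (mul_le_mul_of_nonneg_left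
      ((norm_cosVec_le _).trans_eq (by rw [hE])) (norm_nonneg _))
  have hcos : ∀ z : ℂ, ‖Complex.cos (z * Real.pi)‖ ≤ Real.exp (|z.im| * Real.pi) := fun z =>
    (norm_cos_le _).trans_eq (by rw [hE])
  set A := |omega q h H| + ‖p‖
  set B := ‖b‖ + ‖f‖
  have hA : 0 ≤ A := by positivity
  have hB : 0 ≤ B := by positivity
  have hfront : ∀ N : ℕ, 1 ≤ N → 4 * A < N → ∀ w ∈ frontier
      (Ioo (-(N + 1 / 2 : ℝ)) (N + 1 / 2) ×ℂ Ioo (-(N + 1 / 2 : ℝ)) (N + 1 / 2)),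
      ‖Q w‖ ≤ B / (N / 4 - A) := by
    intro N hN hNA w hw
    obtain ⟨h1, h2⟩ := norm_sin_ge_on_square hN hw
    set E := Real.exp (|w.im| * Real.pi)
    have hEpos : 0 < E := Real.exp_pos _
    have hGw : ‖G w‖ ≤ B * E := by
      refine (norm_sub_le _ _).trans ?_
      rw [norm_mul, add_mul]
      exact add_le_add (mul_le_mul_of_nonneg_left (hcos w) (norm_nonneg _)) (hinle f w)
    have hFw : (N / 4 - A) * E ≤ ‖F w‖ := by
      have e1 : ‖w * Complex.sin (w * Real.pi)‖ ≤ ‖F w‖ + A * E := by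
        have e2 : w * Complex.sin (w * Real.pi) = -F w + ((omega q h H : ℂ) *
            Complex.cos (w * Real.pi) + inner ℂ p (cosVec (w * Real.pi))) := by
          rw [hp]; ring
        rw [e2]
        refine (norm_add_le _ _).trans ?_
        rw [norm_neg, add_mul]
        refine add_le_add le_rfl ((norm_add_le _ _).trans (add_le_add ?_ (hinle p w)))
        rw [norm_mul, Complex.norm_real, Real.norm_eq_abs]
        exact mul_le_mul_of_nonneg_left (hcos w) (abs_nonneg _)
      have e3 : (N : ℝ) * (E / 4) ≤ ‖w * Complex.sin (w * Real.pi)‖ := by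
        rw [norm_mul]
        gcongr
      linarith
    have hpos : 0 < N / 4 - A := by linarith
    have hFpos : 0 < ‖F w‖ := lt_of_lt_of_le (by positivity) hFw
    rw [hQe w (norm_pos_iff.1 hFpos), norm_div, div_le_div_iff₀ hFpos hpos]
    calc ‖G w‖ * (N / 4 - A) ≤ B * E * (N / 4 - A) := by gcongr
      _ = B * ((N / 4 - A) * E) := by ring
      _ ≤ _ := by gcongr
  have hQ0 : Q z = 0 := by
    have hlim : Tendsto (fun N : ℕ => B / ((N : ℝ) / 4 - A)) atTop (𝓝 0) := by
      refine Tendsto.const_div_atTop ?_ B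
      exact tendsto_atTop_add_const_right _ _
        (tendsto_natCast_atTop_atTop.atTop_div_const (by norm_num))
    rw [← norm_le_zero_iff]
    refine ge_of_tendsto hlim ?_
    filter_upwards [eventually_ge_atTop 1, eventually_gt_atTop ⌈4 * A⌉₊,
      eventually_gt_atTop ⌈‖z‖⌉₊] with N h1 h2 h3
    have h2' : 4 * A < N := Nat.lt_of_ceil_lt h2
    have h3' : ‖z‖ < N := Nat.lt_of_ceil_lt h3
    refine Complex.norm_le_of_forall_mem_frontier_norm_le
      ((Metric.isBounded_Ioo _ _).reProdIm (Metric.isBounded_Ioo _ _)) hQ.diffContOnCl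
      (hfront N h1 h2') (subset_closure ?_)
    have hre := abs_le.1 (Complex.abs_re_le_norm z)
    have him := abs_le.1 (Complex.abs_im_le_norm z)
    exact ⟨⟨by linarith [hre.1], by linarith [hre.2]⟩, ⟨by linarith [him.1], by linarith [him.2]⟩⟩
  by_cases h0 : F z = 0
  · exact hzero z h0
  · have := hQe z h0
    rw [hQ0, eq_comm, div_eq_zero_iff] at this
    exact this.resolve_right h0

/-- The functions `⟪f, cos (ρ π ·)⟫` grow more slowly than `cos (ρ π)` along the imaginary axis.
-/
lemma eq_zero_of_forall_cos_eq {b : ℂ} {f : L2I}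
    (hz : ∀ z : ℂ, b * Complex.cos (z * Real.pi) - inner ℂ f (cosVec (z * Real.pi)) = 0) :
    b = 0 := by
  have hle : ∀ y : ℝ, 0 < y → ‖b‖ ≤ 2 * ‖f‖ / √(2 * y) := by
    intro y hy
    have h1 := hz (y * Complex.I / Real.pi)
    have hpi : (Real.pi : ℂ) ≠ 0 := by exact_mod_cast Real.pi_ne_zero
    rw [div_mul_cancel₀ _ hpi, sub_eq_zero, Complex.cos_mul_I, ← Complex.ofReal_cosh] at h1
    have h2 : ‖b‖ * Real.cosh y ≤ ‖f‖ * (Real.exp y / √(2 * y)) := by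
      have e := congrArg norm h1
      rw [norm_mul, Complex.norm_real, Real.norm_eq_abs, abs_of_pos (Real.cosh_pos y)] at e
      rw [e]
      exact (norm_inner_le_norm _ _).trans (by gcongr; exact norm_cosVec_mul_I_le hy)
    have h3 : Real.exp y / 2 ≤ Real.cosh y := by
      rw [Real.cosh_eq]
      linarith [Real.exp_pos (-y)]
    have hE := Real.exp_pos y
    have h4 : ‖b‖ * (Real.exp y / 2) ≤ ‖f‖ * (Real.exp y / √(2 * y)) :=
      (mul_le_mul_of_nonneg_left h3 (norm_nonneg _)).trans h2
    have h5 : ‖b‖ * Real.exp y ≤ 2 * ‖f‖ / √(2 * y) * Real.exp y := by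
      calc ‖b‖ * Real.exp y = 2 * (‖b‖ * (Real.exp y / 2)) := by ring
        _ ≤ 2 * (‖f‖ * (Real.exp y / √(2 * y))) := by linarith
        _ = _ := by ring
    exact le_of_mul_le_mul_right h5 hE
  have hlim : Tendsto (fun y : ℝ => 2 * ‖f‖ / √(2 * y)) atTop (𝓝 0) := by
    refine Tendsto.const_div_atTop ?_ _
    exact Real.tendsto_sqrt_atTop.comp (tendsto_id.const_mul_atTop two_pos)
  rw [← norm_le_zero_iff]
  exact ge_of_tendsto hlim ((eventually_gt_atTop 0).mono hle)

lemma neumannCoeff_eq_zero {f : L2I} (hf : ∀ z : ℂ, inner ℂ f (cosVec z) = 0) (n : ℕ) :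
    neumannCoeff f n = 0 := by
  refine eq_zero_of_tendstoUniformlyOn ?_ n
  exact (tendstoUniformlyOn_neumann f Metric.isBounded_sphere).congr_right fun z _ => hf z

/-- The coefficients `γₙ(π) + H gₙ(π)` are the Neumann coefficients of the kernel of the
characteristic function. -/
lemma IsNSBF.eq_neumannCoeff {g γ : ℕ → ℝ → ℝ} (hg : IsNSBF q h φ dφ g γ) {f : L2I}
    (hf : ∀ z : ℂ, charFun H φ dφ z = -z * Complex.sin (z * Real.pi) +
      (omega q h H : ℂ) * Complex.cos (z * Real.pi) + inner ℂ f (cosVec (z * Real.pi))) (n : ℕ) :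
    ((γ n Real.pi + H * g n Real.pi : ℝ) : ℂ) = neumannCoeff f n := by
  rw [← sub_eq_zero]
  refine eq_zero_of_tendstoUniformlyOn
    (a := fun n => ((γ n Real.pi + H * g n Real.pi : ℝ) : ℂ) - neumannCoeff f n) ?_ n
  obtain ⟨h1, h2⟩ := hg Real.pi pi_mem (Metric.closedBall 0 1) (isCompact_closedBall _ _)
  have h3 := tendstoUniformlyOn_neumann f (Metric.isBounded_sphere (x := (0 : ℂ)) (r := 1))
  rw [Metric.tendstoUniformlyOn_iff] at h1 h2 h3 ⊢
  intro ε hε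
  have hd : 0 < 2 + |H| := by positivity
  have hε' : 0 < ε / (2 + |H|) := by positivity
  filter_upwards [h1 _ hε', h2 _ hε', h3 _ hε'] with N k1 k2 k3 z hz
  have hpi : (Real.pi : ℂ) ≠ 0 := by exact_mod_cast Real.pi_ne_zero
  have hmem : z / Real.pi ∈ Metric.closedBall (0 : ℂ) 1 := by
    rw [mem_closedBall_zero_iff, norm_div, mem_sphere_zero_iff_norm.1 hz, Complex.norm_real,
      Real.norm_eq_abs, abs_of_pos Real.pi_pos, div_le_one Real.pi_pos]
    linarith [Real.pi_gt_three]
  have k1 := k1 _ hmem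
  have k2 := k2 _ hmem
  have k3 := k3 z hz
  have kf := hf (z / Real.pi)
  rw [charFun] at kf
  rw [dist_eq_norm] at k1 k2 k3 ⊢
  rw [div_mul_cancel₀ _ hpi] at kf
  simp only [div_mul_cancel₀ _ hpi] at k1 k2
  set Sg := ∑ n ∈ Finset.range N, (-1) ^ n * (g n Real.pi : ℂ) * sphericalBesselJ (2 * n) z
  set Sγ := ∑ n ∈ Finset.range N, (-1) ^ n * (γ n Real.pi : ℂ) * sphericalBesselJ (2 * n) z
  set Sf := ∑ n ∈ Finset.range N, (-1) ^ n * neumannCoeff f n * sphericalBesselJ (2 * n) z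
  have e : ∑ n ∈ Finset.range N, (-1) ^ n *
      (((γ n Real.pi + H * g n Real.pi : ℝ) : ℂ) - neumannCoeff f n) * sphericalBesselJ (2 * n) z =
      Sγ + H * Sg - Sf := by
    simp only [Sg, Sγ, Sf]
    rw [Finset.mul_sum, ← Finset.sum_add_distrib, ← Finset.sum_sub_distrib]
    refine Finset.sum_congr rfl fun n _ => ?_
    push_cast
    ring
  rw [e]
  set X1 := φ (z / Real.pi) Real.pi - (Complex.cos z + Sg)
  set X2 := dφ (z / Real.pi) Real.pi - (-(z / Real.pi) * Complex.sin z +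
    ((h + 1 / 2 * ∫ s in (0 : ℝ)..Real.pi, q s : ℝ) : ℂ) * Complex.cos z + Sγ)
  set X3 := inner ℂ f (cosVec z) - Sf
  have e2 : (0 : ℂ) - (Sγ + H * Sg - Sf) = X2 + H * X1 - X3 := by
    simp only [X1, X2, X3]
    rw [omega] at kf
    push_cast at kf ⊢
    linear_combination -kf
  rw [e2]
  have hX : ‖X2 + H * X1 - X3‖ ≤ ‖X2‖ + |H| * ‖X1‖ + ‖X3‖ := by
    refine (norm_sub_le _ _).trans (add_le_add ((norm_add_le _ _).trans_eq ?_) le_rfl)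
    rw [norm_mul, Complex.norm_real, Real.norm_eq_abs]
  have hHX : |H| * ‖X1‖ ≤ |H| * (ε / (2 + |H|)) := by gcongr
  have hsum : ε / (2 + |H|) * (2 + |H|) = ε := div_mul_cancel₀ _ hd.ne'
  nlinarith

end Characteristic

end Spectrum

end SturmLiouville

end

theorem mainTheorem3
    (q : ℝ → ℝ)
    (hq : MeasureTheory.MemLp q 2 (MeasureTheory.volume.restrict (Set.Ioo 0 Real.pi)))
    (h H : ℝ)
    (φ dφ : ℂ → ℝ → ℂ) (hφ : SturmLiouville.IsPhi q h φ dφ)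
    (ρ : ℕ → ℝ) (hρ_mono : StrictMono ρ)
    (hρ_spec : Set.range (fun k : ℕ => ((ρ k : ℂ)) ^ 2) = SturmLiouville.spectrum q h H)
    (hρ_zero : ρ 0 = 0) :
    (∃ g γ : ℕ → ℝ → ℝ, SturmLiouville.IsNSBF q h φ dφ g γ) ∧
    ∀ g γ : ℕ → ℝ → ℝ, SturmLiouville.IsNSBF q h φ dφ g γ →
    ∀ hc : ℕ → ℝ, (∀ n : ℕ, hc n = γ n Real.pi + H * g n Real.pi) →
      -- the parameter `ω`
      SturmLiouville.omega q h H = -hc 0 ∧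
      -- the linear system given by the remaining eigenvalues
      SturmLiouville.SolvesSystem ρ hc ∧
      -- the characteristic function
      (∀ z : ℂ,
        Summable (fun n : ℕ =>
          (-1) ^ n * (hc n : ℂ) * SturmLiouville.sphericalBesselJ (2 * n) (z * Real.pi)) ∧
        dφ z Real.pi + H * φ z Real.pi =
          -z * Complex.sin (z * Real.pi) +
            (SturmLiouville.omega q h H : ℂ) * Complex.cos (z * Real.pi) +
            ∑' n : ℕ,
              (-1) ^ n * (hc n : ℂ) * SturmLiouville.sphericalBesselJ (2 * n) (z * Real.pi)) ∧
      -- recovery: the linear system determines the coefficients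
      Summable (fun n : ℕ => hc n ^ 2 / (4 * n + 1)) ∧
      (∀ a : ℕ → ℝ, Summable (fun n : ℕ => a n ^ 2 / (4 * n + 1)) →
        SturmLiouville.SolvesSystem ρ a → a = hc) := by
  open SturmLiouville in
  refine ⟨hφ.exists_isNSBF hq, fun g γ hg hc hhc => ?_⟩
  obtain ⟨f, hf⟩ := hφ.exists_charFun_eq hq H
  have hcf : ∀ n, (hc n : ℂ) = neumannCoeff f n := fun n => by
    rw [hhc, hg.eq_neumannCoeff hf]
  have hzero : ∀ z : ℂ, charFun H φ dφ z = 0 ↔ ∃ k, z ^ 2 = (ρ k : ℂ) ^ 2 := fun z => by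
    rw [hφ.charFun_eq_zero_iff hq, ← hρ_spec]
    exact exists_congr fun k => eq_comm
  have hsum : ∀ z : ℂ, HasSum (fun n : ℕ => (-1) ^ n * (hc n : ℂ) *
      sphericalBesselJ (2 * n) (z * Real.pi)) (inner ℂ f (cosVec (z * Real.pi))) := fun z => by
    simp only [hcf]
    exact hasSum_neumann f _
  -- Zero is an eigenvalue, so the characteristic function vanishes at the origin.
  have hω : omega q h H = -hc 0 := by
    have h1 := hf 0
    rw [(hzero 0).2 ⟨0, by rw [hρ_zero]; simp⟩, zero_mul, inner_cosVec_zero, ← hcf] at h1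
    simp only [neg_zero, zero_mul, Complex.cos_zero, mul_one, zero_add] at h1
    have h2 : omega q h H + hc 0 = 0 := by exact_mod_cast h1.symm
    linarith
  have hsys : SolvesSystem ρ hc := fun k _ => by
    refine ⟨(hsum (ρ k)).summable, ?_⟩
    rw [(hsum (ρ k)).tsum_eq]
    have h1 := hf (ρ k)
    rw [(hzero _).2 ⟨k, rfl⟩, hω] at h1
    push_cast at h1
    linear_combination h1
  refine ⟨hω, hsys, fun z => ⟨(hsum z).summable, ?_⟩, ?_, fun a ha hsa => ?_⟩
  · rw [(hsum z).tsum_eq]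
    exact hf z
  · refine (summable_neumannCoeff f).congr fun n => ?_
    rw [← hcf, Complex.norm_real, Real.norm_eq_abs, sq_abs]
  · -- `p - f` is the kernel whose Neumann coefficients are `a n - hc n`.
    obtain ⟨p, hp⟩ := exists_neumannCoeff_eq a ha
    have hps : ∀ z : ℂ, HasSum (fun n : ℕ => (-1) ^ n * (a n : ℂ) *
        sphericalBesselJ (2 * n) (z * Real.pi)) (inner ℂ p (cosVec (z * Real.pi))) := fun z => by
      simp only [← hp]
      exact hasSum_neumann p _
    have hk : ∀ k, ((a 0 : ℂ) - hc 0) * Complex.cos (ρ k * Real.pi) -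
        inner ℂ (p - f) (cosVec (ρ k * Real.pi)) = 0 := fun k => by
      rw [inner_sub_left]
      -- For `k = 0` the two terms cancel, as `⟪p - f, 1⟫` is the difference of the coefficients
      -- of `j₀`.
      rcases Nat.eq_zero_or_pos k with rfl | hk
      · rw [hρ_zero, Complex.ofReal_zero, zero_mul, inner_cosVec_zero, inner_cosVec_zero, hp, hcf,
          Complex.cos_zero]
        ring
      · have h1 := (hsa k hk).2
        have h2 := (hsys k hk).2
        rw [(hps (ρ k)).tsum_eq] at h1
        rw [(hsum (ρ k)).tsum_eq] at h2
        linear_combination h1 - h2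
    have hroot : ∀ z : ℂ, charFun H φ dφ z = 0 → ∃ k, z = ρ k ∨ z = -ρ k := fun z hz => by
      obtain ⟨k, hk⟩ := (hzero z).1 hz
      exact ⟨k, sq_eq_sq_iff_eq_or_eq_neg.1 hk⟩
    have hG := hφ.eq_zero_of_vanishes (H := H) hq (fun z hz => by
      obtain ⟨k, rfl | rfl⟩ := hroot z hz <;> simp) ((a 0 : ℂ) - hc 0) (p - f) (fun z hz => by
      obtain ⟨k, rfl | rfl⟩ := hroot z hz
      · exact hk k
      · rw [neg_mul, Complex.cos_neg, cosVec_neg]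
        exact hk k)
    have hb := eq_zero_of_forall_cos_eq hG
    have hin : ∀ z : ℂ, inner ℂ (p - f) (cosVec z) = 0 := fun z => by
      have hpi : (Real.pi : ℂ) ≠ 0 := by exact_mod_cast Real.pi_ne_zero
      have := hG (z / Real.pi)
      rw [hb, div_mul_cancel₀ _ hpi] at this
      simpa using this
    funext n
    have h1 := neumannCoeff_eq_zero hin n
    have h2 : neumannCoeff (p - f) n = neumannCoeff p n - neumannCoeff f n := by
      rw [neumannCoeff, neumannCoeff, neumannCoeff, inner_sub_left]
      ring
    rw [h2, hp, ← hcf, sub_eq_zero] at h1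
    exact_mod_cast h1
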